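/- Let $n\ge 2$, $[n]=\{1,\dots,n\}$ and $[\pm n]=\{\pm1,\dots,\pm n\}$. A set partition $I$ of $[\pm n]$ is *signed* if $-K$ is a block of $I$ for every block $K$ of $I$; a block $K$ with $-K=K$ is a *zero block*. Let $P_n^B$ be the set of signed partitions of $[\pm n]$ with at most one zero block. It is a commutative idempotent monoid: the product of $I$ and $J$ is obtained from the join of $I$ and $J$ (the finest set partition coarser than both) by replacing all its zero blocks by their union, and the unit is the partition into singletons. For distinct $a,b\in[\pm n]$ let $\varepsilon_{a,b}\in P_n^B$ be the partition whose blocks are $\{a,b\}$, $\{-a,-b\}$ and singletons (if $b=-a$ these two blocks coincide). Let $\mathcal B_n^B$ be the group generated by $\sigma_0,\dots,\sigma_{n-1}$ subject to (BB1)–(BB3) below. Let $\mathfrak S_n^B$ be the group of permutations $t$ of $[\pm n]$ with $t(-k)=-t(k)$ for all $k$; it acts on $P_n^B$ by applying $t$ to each block. Let $\pi:\mathcal B_n^B\to\mathfrak S_n^B$ be the homomorphism sending $\sigma_0$ to the transposition exchanging $-1$ and $1$, and $\sigma_i$, for $1\le i\le n-1$, to the permutation exchanging $i$ with $i+1$ and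 $-i$ with $-(i+1)$. Let $\rho$ be the action of $\mathcal B_n^B$ on $P_n^B$ obtained by composing $\pi$ with the action of $\mathfrak S_n^B$, and let $T^B\mathcal B_n^B=P_n^B\rtimes_\rho\mathcal B_n^B$ be the set $P_n^B\times\mathcal B_n^B$ with the product $(b,a)(d,c)=(b\,\rho_a(d),\,ac)$. **Theorem.** The monoid $T^B\mathcal B_n^B$ is presented, as a monoid, by the generators $\sigma_0,\dots,\sigma_{n-1}$, $\sigma_0^{-1},\dots,\sigma_{n-1}^{-1}$, $\theta_0,\dots,\theta_{n-1}$ and the following relations, where $i,j$ range over $\{0,1,\dots,n-1\}$ unless restricted further: - (BB0) $\sigma_i\sigma_i^{-1}=\sigma_i^{-1}\sigma_i=1$; - (BB1) $\sigma_0\sigma_1\sigma_0\sigma_1=\sigma_1\sigma_0\sigma_1\sigma_0$; - (BB2) $\sigma_i\sigma_j\sigma_i=\sigma_j\sigma_i\sigma_j$ for $i,j\ge1$, $|i-j|=1$; - (BB3) $\sigma_i\sigma_j=\sigma_j\sigma_i$ for $|i-j|\ge2$; - (TB1) $\theta_i^2=\theta_i$; - (TB2) $\theta_i\theta_j=\theta_j\theta_i$;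 - (TB3) $\theta_0\sigma_1\sigma_0\sigma_1=\sigma_1\sigma_0\sigma_1\theta_0$ and $\theta_1\sigma_0\sigma_1\sigma_0=\sigma_0\sigma_1\sigma_0\theta_1$; - (TB4) $\sigma_i\sigma_j\theta_i=\theta_j\sigma_i\sigma_j$ for $i,j\ge1$, $|i-j|=1$; - (TB5) $\sigma_i\theta_j=\theta_j\sigma_i$ for $|i-j|\ne1$; - (TB6) $\theta_i\theta_j\sigma_i=\theta_j\sigma_i\theta_j=\sigma_i\theta_i\theta_j$ for $|i-j|=1$; - (TB7) $\theta_1\sigma_0\theta_1\sigma_0=\sigma_0\theta_1\sigma_0\theta_1$ and $\theta_0\sigma_1\theta_0\sigma_1=\sigma_1\theta_0\sigma_1\theta_0$; - (TB8) $\sigma_1^2\theta_0=\theta_0\sigma_1^2$ and $\sigma_0^2\theta_1=\theta_1\sigma_0^2$; - (TB9) $\sigma_i\sigma_j^{-1}\theta_i=\theta_j\sigma_i\sigma_j^{-1}$ for $i,j\ge1$, $|i-j|=1$. More precisely, there is an isomorphism from the monoid so presented onto $T^B\mathcal B_n^B$ that sends the generator $\sigma_i$ to $(1,\sigma_i)$,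 the generator $\sigma_i^{-1}$ to $(1,\sigma_i^{-1})$, the generator $\theta_0$ to $(\varepsilon_{-1,1},1)$, and the generator $\theta_i$ to $(\varepsilon_{i,i+1},1)$ for $1\le i\le n-1$. -/

import Mathlib

namespace TiedB

/-! ### The set `[±n]`, signed partitions and type `B` partitions -/

/-- The set `[±n] = {±1, …, ±n}`. -/
def PM (n : ℕ) : Type := {k : ℤ // k ≠ 0 ∧ |k| ≤ (n : ℤ)}

theorem PM.ext {n : ℕ} {x y : PM n} (h : x.1 = y.1) : x = y := Subtype.ext h

instance (n : ℕ) : DecidableEq (PM n) :=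
  inferInstanceAs (DecidableEq {k : ℤ // k ≠ 0 ∧ |k| ≤ (n : ℤ)})

instance (n : ℕ) : Neg (PM n) :=
  ⟨fun x => ⟨-x.1, by simpa using x.2.1, by simpa using x.2.2⟩⟩

@[simp] theorem PM.val_neg {n : ℕ} (x : PM n) : (-x).1 = -x.1 := rfl

@[simp] theorem PM.neg_neg {n : ℕ} (x : PM n) : -(-x) = x := PM.ext (by simp)

/-- The set `-K`, obtained from `K ⊆ [±n]` by changing all signs. -/
def negSet {n : ℕ} (K : Set (PM n)) : Set (PM n) := {x | -x ∈ K}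

/-- Set partitions of `[±n]` are represented by Mathlib's `Setoid`, whose blocks are
`Setoid.classes`; `I ≤ J` says that the blocks of `J` are unions of blocks of `I`, and
`I ⊔ J` is the product (join) of two partitions.  A partition is *signed* if `-K` is a block
for every block `K`. -/
def IsSigned {n : ℕ} (I : Setoid (PM n)) : Prop :=
  ∀ K ∈ I.classes, negSet K ∈ I.classes

/-- A block `K` is a *zero block* if `-K = K`. -/
def IsZeroBlock {n : ℕ} (I : Setoid (PM n)) (K : Set (PM n)) : Prop :=
  K ∈ I.classes ∧ negSet K = K

/-- Partitions of type `B_n`: signed partitions with at most one zero block. -/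
def IsBPartition {n : ℕ} (I : Setoid (PM n)) : Prop :=
  IsSigned I ∧ ∀ K L, IsZeroBlock I K → IsZeroBlock I L → K = L

/-- The zero closure `I₀`: all zero blocks of `I` are replaced by their union. -/
def zeroClosure {n : ℕ} (I : Setoid (PM n)) : Setoid (PM n) where
  r x y := I x y ∨ ((∃ K, IsZeroBlock I K ∧ x ∈ K) ∧ (∃ L, IsZeroBlock I L ∧ y ∈ L))
  iseqv := by
    have key : ∀ {x y}, I x y → (∃ K, IsZeroBlock I K ∧ x ∈ K) →
        (∃ K, IsZeroBlock I K ∧ y ∈ K) := by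
      rintro x y h ⟨K, hK, hx⟩
      refine ⟨K, hK, ?_⟩
      obtain ⟨z, rfl⟩ := hK.1
      exact I.trans (I.symm h) hx
    refine ⟨fun x => Or.inl (I.refl x), ?_, ?_⟩
    · rintro x y (h | ⟨h, h'⟩)
      · exact Or.inl (I.symm h)
      · exact Or.inr ⟨h', h⟩
    · rintro x y z (h | ⟨h, h'⟩) (g | ⟨g, g'⟩)
      · exact Or.inl (I.trans h g)
      · exact Or.inr ⟨key (I.symm h) g, g'⟩
      · exact Or.inr ⟨h, key g h'⟩
      · exact Or.inr ⟨h, g'⟩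

theorem isSigned_iff {n : ℕ} (I : Setoid (PM n)) :
    IsSigned I ↔ ∀ x y, I x y → I (-x) (-y) := by
  constructor
  · intro h x y hxy
    have h1 := h _ (Setoid.mem_classes I y)
    obtain ⟨z, hz⟩ := h1
    have hx : (-x) ∈ {x | I x z} := by rw [← hz]; simpa [negSet] using hxy
    have hy : (-y) ∈ {x | I x z} := by rw [← hz]; simp [negSet]
    exact I.trans hx (I.symm hy)
  · rintro h K ⟨y, rfl⟩
    refine ⟨-y, ?_⟩
    ext x
    constructor
    · intro hx
      have := h _ _ hx
      rwa [PM.neg_neg] at this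
    · intro hx
      have := h _ _ hx
      rwa [PM.neg_neg] at this

theorem mem_zeroBlock_iff {n : ℕ} {I : Setoid (PM n)} (h : IsSigned I) (x : PM n) :
    (∃ K, IsZeroBlock I K ∧ x ∈ K) ↔ I x (-x) := by
  rw [isSigned_iff] at h
  constructor
  · rintro ⟨K, ⟨⟨z, rfl⟩, hK⟩, hx⟩
    have : (-x) ∈ negSet {x | I x z} := by simpa [negSet] using hx
    rw [hK] at this
    exact I.trans hx (I.symm this)
  · intro hx
    refine ⟨_, ⟨Setoid.mem_classes I x, ?_⟩, I.refl x⟩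
    ext y
    constructor
    · intro hy
      have := h _ _ hy
      rw [PM.neg_neg] at this
      exact I.trans this (I.symm hx)
    · intro hy
      exact I.trans (h _ _ hy) (I.symm hx)

theorem zeroClosure_apply {n : ℕ} {I : Setoid (PM n)} (h : IsSigned I) (x y : PM n) :
    zeroClosure I x y ↔ I x y ∨ (I x (-x) ∧ I y (-y)) := by
  rw [← mem_zeroBlock_iff h, ← mem_zeroBlock_iff h]
  rfl

theorem isBPartition_iff {n : ℕ} (I : Setoid (PM n)) :
    IsBPartition I ↔
      IsSigned I ∧ ∀ x y, I x (-x) → I y (-y) → I x y := by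
  refine and_congr_right fun h => ?_
  constructor
  · intro H x y hx hy
    obtain ⟨K, hK, hxK⟩ := (mem_zeroBlock_iff h x).2 hx
    obtain ⟨L, hL, hyL⟩ := (mem_zeroBlock_iff h y).2 hy
    obtain rfl := H K L hK hL
    exact (Setoid.rel_iff_exists_classes I).2 ⟨K, hK.1, hxK, hyL⟩
  · rintro H K L hK hL
    obtain ⟨x, rfl⟩ := hK.1
    obtain ⟨y, rfl⟩ := hL.1
    have hx := (mem_zeroBlock_iff h x).1 ⟨_, hK, I.refl x⟩
    have hy := (mem_zeroBlock_iff h y).1 ⟨_, hL, I.refl y⟩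
    have hxy := H x y hx hy
    ext z
    exact ⟨fun hz => I.trans hz hxy, fun hz => I.trans hz (I.symm hxy)⟩

theorem isSigned_sup {n : ℕ} {I J : Setoid (PM n)} (hI : IsSigned I) (hJ : IsSigned J) :
    IsSigned (I ⊔ J) := by
  rw [isSigned_iff] at *
  have : I ⊔ J ≤ Setoid.comap (fun x : PM n => -x) (I ⊔ J) :=
    sup_le (fun x y h => (le_sup_left : I ≤ I ⊔ J) (hI _ _ h))
      (fun x y h => (le_sup_right : J ≤ I ⊔ J) (hJ _ _ h))
  exact fun x y h => this h

theorem isBPartition_zeroClosure {n : ℕ} {I : Setoid (PM n)} (h : IsSigned I) :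
    IsBPartition (zeroClosure I) := by
  rw [isBPartition_iff, isSigned_iff]
  have h' := (isSigned_iff I).1 h
  have hz : ∀ x, zeroClosure I x (-x) → I x (-x) := by
    intro x hx
    rw [zeroClosure_apply h] at hx
    exact hx.elim id And.left
  refine ⟨fun x y hxy => ?_, fun x y hx hy => ?_⟩
  · rw [zeroClosure_apply h] at hxy ⊢
    exact hxy.imp (h' _ _) (fun g => ⟨h' _ _ g.1, h' _ _ g.2⟩)
  · rw [zeroClosure_apply h]
    exact Or.inr ⟨hz x hx, hz y hy⟩

theorem le_zeroClosure {n : ℕ} (I : Setoid (PM n)) : I ≤ zeroClosure I :=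
  fun _ _ h => Or.inl h

theorem zeroClosure_le {n : ℕ} {I K : Setoid (PM n)} (h : IsSigned I) (hK : IsBPartition K)
    (hIK : I ≤ K) : zeroClosure I ≤ K := by
  intro x y hxy
  rw [zeroClosure_apply h] at hxy
  rcases hxy with hxy | ⟨hx, hy⟩
  · exact hIK hxy
  · exact ((isBPartition_iff K).1 hK).2 x y (hIK hx) (hIK hy)

/-! ### The monoid `P_n^B` -/

/-- The set `P_n^B` of partitions of type `B_n`. -/
@[ext] structure PB (n : ℕ) where
  part : Setoid (PM n)
  isB : IsBPartition part

/-- The product `I ·_B J` is the zero closure of the join `IJ`. -/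
instance (n : ℕ) : Mul (PB n) :=
  ⟨fun I J => ⟨zeroClosure (I.part ⊔ J.part),
    isBPartition_zeroClosure (isSigned_sup I.isB.1 J.isB.1)⟩⟩

/-- The unit is the partition into singletons. -/
instance (n : ℕ) : One (PB n) :=
  ⟨⟨⊥, (isBPartition_iff _).2 ⟨(isSigned_iff _).2 fun x y (h : x = y) => congrArg Neg.neg h,
    fun x _ (h : x = -x) => by
      have h1 := congrArg Subtype.val h
      have h2 := x.2.1
      simp only [PM.val_neg] at h1
      omega⟩⟩⟩

theorem PB.mul_part {n : ℕ} (I J : PB n) : (I * J).part = zeroClosure (I.part ⊔ J.part) := rfl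

theorem PB.one_part {n : ℕ} : (1 : PB n).part = ⊥ := rfl

theorem PB.mul_part_le_iff {n : ℕ} (I J K : PB n) :
    (I * J).part ≤ K.part ↔ I.part ≤ K.part ∧ J.part ≤ K.part := by
  rw [← sup_le_iff]
  exact ⟨fun h => (le_zeroClosure _).trans h,
    fun h => zeroClosure_le (isSigned_sup I.isB.1 J.isB.1) K.isB h⟩

theorem PB.eq_of_le_iff {n : ℕ} {I J : PB n}
    (h : ∀ K : PB n, I.part ≤ K.part ↔ J.part ≤ K.part) : I = J :=
  PB.ext (le_antisymm ((h J).2 le_rfl) ((h I).1 le_rfl))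

instance (n : ℕ) : CommMonoid (PB n) where
  mul_assoc I J K := PB.eq_of_le_iff fun L => by simp only [PB.mul_part_le_iff, and_assoc]
  one_mul I := PB.eq_of_le_iff fun L => by simp [PB.mul_part_le_iff, PB.one_part]
  mul_one I := PB.eq_of_le_iff fun L => by simp [PB.mul_part_le_iff, PB.one_part]
  mul_comm I J := PB.eq_of_le_iff fun L => by simp only [PB.mul_part_le_iff, and_comm]

/-- `μ_X`: the partition of `[±n]` whose only block that may have more than one element
is `X`. -/
def mu {n : ℕ} (X : Set (PM n)) : Setoid (PM n) where
  r x y := x = y ∨ (x ∈ X ∧ y ∈ X)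
  iseqv := by
    refine ⟨fun x => Or.inl rfl, ?_, ?_⟩
    · rintro x y (h | ⟨h, h'⟩)
      · exact Or.inl h.symm
      · exact Or.inr ⟨h', h⟩
    · rintro x y z (rfl | ⟨h, h'⟩) (rfl | ⟨g, g'⟩)
      · exact Or.inl rfl
      · exact Or.inr ⟨g, g'⟩
      · exact Or.inr ⟨h, h'⟩
      · exact Or.inr ⟨h, g'⟩

theorem isSigned_mu_sup {n : ℕ} (X : Set (PM n)) : IsSigned (mu (negSet X) ⊔ mu X) := by
  rw [isSigned_iff]
  have key : mu (negSet X) ⊔ mu X ≤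
      Setoid.comap (fun x : PM n => -x) (mu (negSet X) ⊔ mu X) := by
    refine sup_le ?_ ?_
    · rintro x y (rfl | h)
      · exact (mu (negSet X) ⊔ mu X).refl _
      · exact (le_sup_right : mu X ≤ mu (negSet X) ⊔ mu X) (Or.inr h)
    · rintro x y (rfl | ⟨hx, hy⟩)
      · exact (mu (negSet X) ⊔ mu X).refl _
      · exact (le_sup_left : mu (negSet X) ≤ mu (negSet X) ⊔ mu X)
          (Or.inr ⟨by simpa [negSet] using hx, by simpa [negSet] using hy⟩)
  exact fun x y h => key h

/-- `ε_{a,b} = (μ_{{-a,-b}} μ_{{a,b}})₀`, an element of `P_n^B`. -/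
def eps {n : ℕ} (a b : PM n) : PB n :=
  ⟨zeroClosure (mu (negSet {a, b}) ⊔ mu {a, b}), isBPartition_zeroClosure (isSigned_mu_sup _)⟩

/-! ### The signed symmetric group and its action on `P_n^B` -/

/-- The signed symmetric group: permutations `t` of `[±n]` with `t(-k) = -t(k)`. -/
def SignedPerm (n : ℕ) : Subgroup (Equiv.Perm (PM n)) where
  carrier := {t | ∀ k, t (-k) = -t k}
  one_mem' := fun _ => rfl
  mul_mem' := by
    intro s t hs ht k
    rw [Equiv.Perm.mul_apply, Equiv.Perm.mul_apply, ht k, hs (t k)]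
  inv_mem' := by
    intro t ht k
    rw [Equiv.Perm.inv_eq_iff_eq, ht]
    exact congrArg Neg.neg (t.apply_symm_apply k).symm

theorem SignedPerm.map_neg {n : ℕ} (t : SignedPerm n) (k : PM n) : t.1 (-k) = -t.1 k := t.2 k

/-- `t(I) = {t(I_1), …, t(I_k)}`: two elements lie in the same block of `t(I)` if and only if
their preimages under `t` lie in the same block of `I`. -/
def permPart {n : ℕ} (t : Equiv.Perm (PM n)) (I : Setoid (PM n)) : Setoid (PM n) :=
  Setoid.comap (fun x => t⁻¹ x) I

theorem permPart_apply {n : ℕ} (t : Equiv.Perm (PM n)) (I : Setoid (PM n)) (x y : PM n) :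
    permPart t I x y ↔ I (t⁻¹ x) (t⁻¹ y) := Iff.rfl

theorem classes_permPart {n : ℕ} (t : Equiv.Perm (PM n)) (I : Setoid (PM n)) :
    (permPart t I).classes = (fun K => t '' K) '' I.classes := by
  ext K
  constructor
  · rintro ⟨y, rfl⟩
    refine ⟨_, ⟨t⁻¹ y, rfl⟩, ?_⟩
    ext x
    simp [Equiv.image_eq_preimage_symm, permPart_apply, Equiv.Perm.inv_def]
  · rintro ⟨_, ⟨y, rfl⟩, rfl⟩
    refine ⟨t y, ?_⟩
    ext x
    simp [Equiv.image_eq_preimage_symm, permPart_apply, Equiv.Perm.inv_def]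

theorem isBPartition_permPart {n : ℕ} (t : SignedPerm n) {I : Setoid (PM n)}
    (hI : IsBPartition I) : IsBPartition (permPart t.1 I) := by
  have ht : ∀ k, t.1⁻¹ (-k) = -t.1⁻¹ k := fun k => SignedPerm.map_neg t⁻¹ k
  rw [isBPartition_iff, isSigned_iff] at *
  refine ⟨fun x y h => ?_, fun x y hx hy => ?_⟩
  · rw [permPart_apply] at *
    rw [ht, ht]
    exact hI.1 _ _ h
  · rw [permPart_apply, ht] at *
    exact hI.2 _ _ hx hy

/-- The action of a signed permutation on `P_n^B`. -/
def permPB {n : ℕ} (t : SignedPerm n) (I : PB n) : PB n :=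
  ⟨permPart t.1 I.part, isBPartition_permPart t I.isB⟩

theorem permPB_mul {n : ℕ} (s t : SignedPerm n) (I : PB n) :
    permPB (s * t) I = permPB s (permPB t I) := by
  apply PB.ext
  ext x y
  change I.part ((s.1 * t.1)⁻¹ x) ((s.1 * t.1)⁻¹ y) ↔ I.part (t.1⁻¹ (s.1⁻¹ x)) (t.1⁻¹ (s.1⁻¹ y))
  rw [mul_inv_rev]
  rfl

theorem permPB_one {n : ℕ} (I : PB n) : permPB 1 I = I := rfl

theorem permPB_mono {n : ℕ} (t : SignedPerm n) {I J : PB n} (h : I.part ≤ J.part) :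
    (permPB t I).part ≤ (permPB t J).part := fun _ _ hxy => h hxy

theorem permPB_le_iff {n : ℕ} (t : SignedPerm n) (I J : PB n) :
    (permPB t I).part ≤ J.part ↔ I.part ≤ (permPB t⁻¹ J).part := by
  constructor
  · intro h
    have := permPB_mono t⁻¹ h
    rwa [← permPB_mul, inv_mul_cancel, permPB_one] at this
  · intro h
    have := permPB_mono t h
    rwa [← permPB_mul, mul_inv_cancel, permPB_one] at this

/-- The permutation action `𝗉` of the signed symmetric group on the monoid `P_n^B`. -/
def permAction (n : ℕ) : SignedPerm n →* Monoid.End (PB n) where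
  toFun t :=
    { toFun := permPB t
      map_one' := PB.eq_of_le_iff fun K => by simp [permPB_le_iff, PB.one_part]
      map_mul' := fun I J => PB.eq_of_le_iff fun K => by
        simp only [permPB_le_iff, PB.mul_part_le_iff] }
  map_one' := MonoidHom.ext fun I => permPB_one I
  map_mul' s t := MonoidHom.ext fun I => permPB_mul s t I

/-! ### The braid group of type `B` and its projection to the signed symmetric group -/

/-- The element `i + 1` of `[n]`, for `i = 0, …, n - 1`. -/
def pos {n : ℕ} (i : Fin n) : PM n :=
  ⟨(i : ℤ) + 1, by omega, by have := i.2; rw [abs_of_nonneg] <;> omega⟩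

/-- The element `i` of `[n]`, for `i = 1, …, n - 1`. -/
def posPred {n : ℕ} (i : Fin n) (hi : i.1 ≠ 0) : PM n :=
  ⟨(i : ℤ), by omega, by have := i.2; rw [abs_of_nonneg] <;> omega⟩

/-- The generators of the signed symmetric group: `t_0` exchanges `-1` and `1`, and for
`i ≥ 1` the signed transposition `t_i` exchanges `i` with `i + 1` and `-i` with `-(i + 1)`. -/
noncomputable def tPerm {n : ℕ} (i : Fin n) : Equiv.Perm (PM n) :=
  if hi : i.1 = 0 then Equiv.swap (-pos i) (pos i)
  else Equiv.swap (-posPred i hi) (-pos i) * Equiv.swap (posPred i hi) (pos i)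

@[simp] theorem pos_val {n : ℕ} (i : Fin n) : (pos i).1 = (i : ℤ) + 1 := rfl

@[simp] theorem posPred_val {n : ℕ} (i : Fin n) (hi : i.1 ≠ 0) : (posPred i hi).1 = (i : ℤ) := rfl

theorem swap_val {n : ℕ} (a b x : PM n) :
    (Equiv.swap a b x).1 = if x.1 = a.1 then b.1 else if x.1 = b.1 then a.1 else x.1 := by
  have h1 : x = a ↔ x.1 = a.1 := ⟨fun h => h ▸ rfl, PM.ext⟩
  have h2 : x = b ↔ x.1 = b.1 := ⟨fun h => h ▸ rfl, PM.ext⟩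
  rw [Equiv.swap_apply_def]
  simp only [h1, h2]
  split_ifs <;> rfl

theorem tPerm_val {n : ℕ} (i : Fin n) (x : PM n) :
    (tPerm i x).1 = if i.1 = 0 then (if x.1 = 1 then -1 else if x.1 = -1 then 1 else x.1)
      else if x.1 = i then (i : ℤ) + 1 else if x.1 = (i : ℤ) + 1 then (i : ℤ)
      else if x.1 = -(i : ℤ) then -((i : ℤ) + 1) else if x.1 = -((i : ℤ) + 1) then -(i : ℤ)
      else x.1 := by
  have hx := x.2.1
  unfold tPerm
  by_cases h0 : i.1 = 0
  all_goals simp only [h0, dite_true, dite_false, if_true, if_false]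
  all_goals
    simp only [swap_val, Equiv.Perm.mul_apply, PM.val_neg, pos_val, posPred_val]
    grind

theorem tPerm_spec {n : ℕ} (i : Fin n) (hi : i.1 ≠ 0) (x : PM n) :
    (x.1 = i ∧ (tPerm i x).1 = (i : ℤ) + 1) ∨ (x.1 = (i : ℤ) + 1 ∧ (tPerm i x).1 = i) ∨
    (x.1 = -(i : ℤ) ∧ (tPerm i x).1 = -((i : ℤ) + 1)) ∨
    (x.1 = -((i : ℤ) + 1) ∧ (tPerm i x).1 = -(i : ℤ)) ∨
    (x.1 ≠ i ∧ x.1 ≠ (i : ℤ) + 1 ∧ x.1 ≠ -(i : ℤ) ∧ x.1 ≠ -((i : ℤ) + 1) ∧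
      (tPerm i x).1 = x.1) := by
  rw [tPerm_val, if_neg hi]
  split_ifs <;> omega

theorem tPerm_spec_zero {n : ℕ} (i : Fin n) (hi : i.1 = 0) (x : PM n) :
    (x.1 = 1 ∧ (tPerm i x).1 = -1) ∨ (x.1 = -1 ∧ (tPerm i x).1 = 1) ∨
    (x.1 ≠ 1 ∧ x.1 ≠ -1 ∧ (tPerm i x).1 = x.1) := by
  rw [tPerm_val, if_pos hi]
  split_ifs <;> omega

theorem tPerm_mem {n : ℕ} (i : Fin n) : tPerm i ∈ SignedPerm n := by
  intro k
  apply PM.ext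
  have hx := k.2.1
  simp only [tPerm_val, PM.val_neg]
  split_ifs <;> omega

/-- `t_i` as an element of the signed symmetric group. -/
noncomputable def t {n : ℕ} (i : Fin n) : SignedPerm n := ⟨tPerm i, tPerm_mem i⟩

/-- The defining relations of the braid group of type `B`, on `σ_0, …, σ_{n-1}`; a relation
`u = v` is recorded as `u * v⁻¹`. -/
inductive BraidRel (n : ℕ) : FreeGroup (Fin n) → Prop
  | bb1 (i j : Fin n) (hi : i.1 = 0) (hj : j.1 = 1) :
      BraidRel n (.of i * .of j * .of i * .of j * (.of j * .of i * .of j * .of i)⁻¹)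
  | bb2 (i j : Fin n) (hi : 1 ≤ i.1) (hj : 1 ≤ j.1) (hij : |(i : ℤ) - j| = 1) :
      BraidRel n (.of i * .of j * .of i * (.of j * .of i * .of j)⁻¹)
  | bb3 (i j : Fin n) (hij : 2 ≤ |(i : ℤ) - j|) :
      BraidRel n (.of i * .of j * (.of j * .of i)⁻¹)

/-- The braid group `𝓑_n^B` of type `B`. -/
abbrev BraidB (n : ℕ) : Type := PresentedGroup {r | BraidRel n r}

theorem signedPerm_ext {n : ℕ} {f g : SignedPerm n} (h : ∀ x, (f.1 x).1 = (g.1 x).1) : f = g :=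
  Subtype.ext (Equiv.ext fun x => PM.ext (h x))

theorem t_bb1 {n : ℕ} (i j : Fin n) (hi : i.1 = 0) (hj1 : j.1 = 1) :
    t i * t j * t i * t j = t j * t i * t j * t i := by
  refine signedPerm_ext fun x => ?_
  have hx := x.2.1
  have hj : j.1 ≠ 0 := by omega
  simp only [Subgroup.coe_mul, Equiv.Perm.mul_apply, t]
  all_goals
    rcases tPerm_spec j hj x with h0 | h0 | h0 | h0 | h0
  all_goals
    rcases tPerm_spec_zero i hi (tPerm j x) with h1 | h1 | h1 <;> first | (exfalso; omega) | skip
  all_goals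
    rcases tPerm_spec j hj (tPerm i (tPerm j x)) with h2 | h2 | h2 | h2 | h2 <;> first | (exfalso; omega) | skip
  all_goals
    rcases tPerm_spec_zero i hi (tPerm j (tPerm i (tPerm j x))) with h3 | h3 | h3 <;> first | (exfalso; omega) | skip
  all_goals
    rcases tPerm_spec_zero i hi x with h4 | h4 | h4 <;> first | (exfalso; omega) | skip
  all_goals
    rcases tPerm_spec j hj (tPerm i x) with h5 | h5 | h5 | h5 | h5 <;> first | (exfalso; omega) | skip
  all_goals
    rcases tPerm_spec_zero i hi (tPerm j (tPerm i x)) with h6 | h6 | h6 <;> first | (exfalso; omega) | skip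
  all_goals
    rcases tPerm_spec j hj (tPerm i (tPerm j (tPerm i x))) with h7 | h7 | h7 | h7 | h7 <;> first | (exfalso; omega) | skip
  all_goals omega

set_option maxHeartbeats 1000000 in
theorem t_bb2 {n : ℕ} (i j : Fin n) (hi : i.1 ≠ 0) (hj : j.1 ≠ 0) (hij : (i : ℤ) - j = 1) :
    t i * t j * t i = t j * t i * t j := by
  refine signedPerm_ext fun x => ?_
  have hx := x.2.1
  simp only [Subgroup.coe_mul, Equiv.Perm.mul_apply, t]
  all_goals
    rcases tPerm_spec i hi x with h0 | h0 | h0 | h0 | h0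
  all_goals
    rcases tPerm_spec j hj (tPerm i x) with h1 | h1 | h1 | h1 | h1 <;> first | (exfalso; omega) | skip
  all_goals
    rcases tPerm_spec i hi (tPerm j (tPerm i x)) with h2 | h2 | h2 | h2 | h2 <;> first | (exfalso; omega) | skip
  all_goals
    rcases tPerm_spec j hj x with h3 | h3 | h3 | h3 | h3 <;> first | (exfalso; omega) | skip
  all_goals
    rcases tPerm_spec i hi (tPerm j x) with h4 | h4 | h4 | h4 | h4 <;> first | (exfalso; omega) | skip
  all_goals
    rcases tPerm_spec j hj (tPerm i (tPerm j x)) with h5 | h5 | h5 | h5 | h5 <;> first | (exfalso; omega) | skip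
  all_goals omega

set_option maxHeartbeats 1000000 in
theorem t_bb3 {n : ℕ} (i j : Fin n) (hij : 2 ≤ (i : ℤ) - j) : t i * t j = t j * t i := by
  refine signedPerm_ext fun x => ?_
  have hx := x.2.1
  have hi : i.1 ≠ 0 := by omega
  simp only [Subgroup.coe_mul, Equiv.Perm.mul_apply, t]
  by_cases hj : j.1 = 0
  · clear hx
    all_goals
      rcases tPerm_spec_zero j hj x with h0 | h0 | h0
    all_goals
      rcases tPerm_spec i hi (tPerm j x) with h1 | h1 | h1 | h1 | h1 <;> first | (exfalso; omega) | skip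
    all_goals
      rcases tPerm_spec i hi x with h2 | h2 | h2 | h2 | h2 <;> first | (exfalso; omega) | skip
    all_goals
      rcases tPerm_spec_zero j hj (tPerm i x) with h3 | h3 | h3 <;> first | (exfalso; omega) | skip
    all_goals omega
  · clear hx
    all_goals
      rcases tPerm_spec j hj x with h0 | h0 | h0 | h0 | h0
    all_goals
      rcases tPerm_spec i hi (tPerm j x) with h1 | h1 | h1 | h1 | h1 <;> first | (exfalso; omega) | skip
    all_goals
      rcases tPerm_spec i hi x with h2 | h2 | h2 | h2 | h2 <;> first | (exfalso; omega) | skip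
    all_goals
      rcases tPerm_spec j hj (tPerm i x) with h3 | h3 | h3 | h3 | h3 <;> first | (exfalso; omega) | skip
    all_goals omega

theorem t_rel {n : ℕ} (r : FreeGroup (Fin n)) (hr : r ∈ {r | BraidRel n r}) :
    FreeGroup.lift t r = 1 := by
  cases hr with
  | bb1 i j hi hj =>
    simp only [map_mul, map_inv, FreeGroup.lift_apply_of, mul_inv_eq_one]
    exact t_bb1 i j hi hj
  | bb2 i j hi hj hij =>
    simp only [map_mul, map_inv, FreeGroup.lift_apply_of, mul_inv_eq_one]
    rw [abs_eq (by norm_num)] at hij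
    rcases hij with h | h
    · exact t_bb2 i j (by omega) (by omega) h
    · exact (t_bb2 j i (by omega) (by omega) (by omega)).symm
  | bb3 i j hij =>
    simp only [map_mul, map_inv, FreeGroup.lift_apply_of, mul_inv_eq_one]
    rw [le_abs] at hij
    rcases hij with h | h
    · exact t_bb3 i j h
    · exact (t_bb3 j i (by omega)).symm

/-- The natural projection `π` with `π(σ_i) = t_i`. -/
noncomputable def proj (n : ℕ) : BraidB n →* SignedPerm n :=
  PresentedGroup.toGroup (f := t) t_rel

/-- The action `ρ = 𝗉 ∘ π` of the braid group on `P_n^B`. -/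
noncomputable def rho (n : ℕ) : BraidB n →* Monoid.End (PB n) := (permAction n).comp (proj n)

/-! ### Semidirect products of monoids and the tied monoid -/

/-- The semidirect product `N ⋊_ρ M` of monoids: the set `N × M` with
`(b, a) (d, c) = (b ρ_a(d), a c)`. -/
@[ext] structure MonoidSemidirect (N M : Type*) [Monoid N] [Monoid M]
    (ρ : M →* Monoid.End N) where
  left : N
  right : M

instance {N M : Type*} [Monoid N] [Monoid M] (ρ : M →* Monoid.End N) :
    Mul (MonoidSemidirect N M ρ) :=
  ⟨fun x y => ⟨x.left * ρ x.right y.left, x.right * y.right⟩⟩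

instance {N M : Type*} [Monoid N] [Monoid M] (ρ : M →* Monoid.End N) :
    One (MonoidSemidirect N M ρ) := ⟨⟨1, 1⟩⟩

theorem MonoidSemidirect.mul_def {N M : Type*} [Monoid N] [Monoid M] {ρ : M →* Monoid.End N}
    (x y : MonoidSemidirect N M ρ) :
    x * y = ⟨x.left * ρ x.right y.left, x.right * y.right⟩ := rfl

theorem MonoidSemidirect.one_def {N M : Type*} [Monoid N] [Monoid M] {ρ : M →* Monoid.End N} :
    (1 : MonoidSemidirect N M ρ) = ⟨1, 1⟩ := rfl

instance {N M : Type*} [Monoid N] [Monoid M] (ρ : M →* Monoid.End N) :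
    Monoid (MonoidSemidirect N M ρ) where
  mul_assoc x y z := by
    simp [MonoidSemidirect.mul_def, mul_assoc]
  one_mul x := by simp [MonoidSemidirect.mul_def, MonoidSemidirect.one_def]
  mul_one x := by simp [MonoidSemidirect.mul_def, MonoidSemidirect.one_def]

/-- The tied monoid `T^B 𝓑_n^B = P_n^B ⋊_ρ 𝓑_n^B`. -/
abbrev TiedMonoid (n : ℕ) : Type := MonoidSemidirect (PB n) (BraidB n) (rho n)

/-- The braid `σ_i` as an element of the braid group. -/
def braidGen {n : ℕ} (i : Fin n) : BraidB n := PresentedGroup.of i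

/-- `θ_0 = ε_{-1,1}` and `θ_i = ε_{i,i+1}` for `i ≥ 1`. -/
def thetaPB {n : ℕ} (i : Fin n) : PB n :=
  if hi : i.1 = 0 then eps (-pos i) (pos i) else eps (posPred i hi) (pos i)

/-! ### The presentation -/

/-- The generating symbols `σ_i`, `σ_i⁻¹` and `θ_i`, for `i = 0, …, n - 1`. -/
inductive Gen (n : ℕ) : Type
  | sigma (i : Fin n)
  | sigmaInv (i : Fin n)
  | theta (i : Fin n)

/-- The one-letter word `σ_i`. -/
def s {n : ℕ} (i : Fin n) : FreeMonoid (Gen n) := FreeMonoid.of (.sigma i)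

/-- The one-letter word `σ_i⁻¹`. -/
def s' {n : ℕ} (i : Fin n) : FreeMonoid (Gen n) := FreeMonoid.of (.sigmaInv i)

/-- The one-letter word `θ_i`. -/
def θ {n : ℕ} (i : Fin n) : FreeMonoid (Gen n) := FreeMonoid.of (.theta i)

/-- The defining relations. A pair `(z, o)` with values `0` and `1` stands for the indices
`0` and `1`. -/
inductive TiedRel (n : ℕ) : FreeMonoid (Gen n) → FreeMonoid (Gen n) → Prop
  | bb0_right (i : Fin n) : TiedRel n (s i * s' i) 1
  | bb0_left (i : Fin n) : TiedRel n (s' i * s i) 1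
  | bb1 (z o : Fin n) (hz : z.1 = 0) (ho : o.1 = 1) :
      TiedRel n (s z * s o * s z * s o) (s o * s z * s o * s z)
  | bb2 (i j : Fin n) (hi : 1 ≤ i.1) (hj : 1 ≤ j.1) (hij : |(i : ℤ) - j| = 1) :
      TiedRel n (s i * s j * s i) (s j * s i * s j)
  | bb3 (i j : Fin n) (hij : 2 ≤ |(i : ℤ) - j|) :
      TiedRel n (s i * s j) (s j * s i)
  | tb1 (i : Fin n) : TiedRel n (θ i * θ i) (θ i)
  | tb2 (i j : Fin n) : TiedRel n (θ i * θ j) (θ j * θ i)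
  | tb3_zero (z o : Fin n) (hz : z.1 = 0) (ho : o.1 = 1) :
      TiedRel n (θ z * s o * s z * s o) (s o * s z * s o * θ z)
  | tb3_one (z o : Fin n) (hz : z.1 = 0) (ho : o.1 = 1) :
      TiedRel n (θ o * s z * s o * s z) (s z * s o * s z * θ o)
  | tb4 (i j : Fin n) (hi : 1 ≤ i.1) (hj : 1 ≤ j.1) (hij : |(i : ℤ) - j| = 1) :
      TiedRel n (s i * s j * θ i) (θ j * s i * s j)
  | tb5 (i j : Fin n) (hij : |(i : ℤ) - j| ≠ 1) :
      TiedRel n (s i * θ j) (θ j * s i)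
  | tb6_left (i j : Fin n) (hij : |(i : ℤ) - j| = 1) :
      TiedRel n (θ i * θ j * s i) (θ j * s i * θ j)
  | tb6_right (i j : Fin n) (hij : |(i : ℤ) - j| = 1) :
      TiedRel n (θ j * s i * θ j) (s i * θ i * θ j)
  | tb7_zero (z o : Fin n) (hz : z.1 = 0) (ho : o.1 = 1) :
      TiedRel n (θ o * s z * θ o * s z) (s z * θ o * s z * θ o)
  | tb7_one (z o : Fin n) (hz : z.1 = 0) (ho : o.1 = 1) :
      TiedRel n (θ z * s o * θ z * s o) (s o * θ z * s o * θ z)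
  | tb8_zero (z o : Fin n) (hz : z.1 = 0) (ho : o.1 = 1) :
      TiedRel n (s o * s o * θ z) (θ z * s o * s o)
  | tb8_one (z o : Fin n) (hz : z.1 = 0) (ho : o.1 = 1) :
      TiedRel n (s z * s z * θ o) (θ o * s z * s z)
  | tb9 (i j : Fin n) (hi : 1 ≤ i.1) (hj : 1 ≤ j.1) (hij : |(i : ℤ) - j| = 1) :
      TiedRel n (s i * s' j * θ i) (θ j * s i * s' j)

/-- The monoid presented by the generators and relations above. -/
abbrev Presented (n : ℕ) : Type := PresentedMonoid (TiedRel n)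

end TiedB

namespace TiedB

/-! ### Actions of the braid relations of type `B` compatible with ties -/

/-! In the presented monoid every `σ_i` is a unit, so the braid group acts by conjugation. To each
pair `{a, b}` of distinct points, taken up to sign, is attached one conjugate `tie a b` of a
generator `θ_i`, and conjugation by a braid `g` carries it to the tie of the pair moved by `π(g)`.
This is `TiedAction.braid_smul_tieAt`, proved for an abstract action by writing each conjugate in a
normal form and following it under every generator; in particular pure braids commute with all ties.

Braids move `1, …, k` to any `k` points with distinct absolute values (`exists_braid_tuple`). An
identity between ties therefore needs checking only for pairs of small points, where a tie is a
generator `θ_i` or its conjugate by a single `σ_j`. It follows that ties are commuting idempotents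
and satisfy two absorption laws: `tie_mul_tie_mul_tie`, which mirrors transitivity, and
`tie_mul_tie_neg_neg_mul`, which mirrors the merging of zero blocks.

The two laws say that the pairs whose ties are absorbed by an element `S` form a partition of type
`B`, namely `absorbed`. Let `tieProd I` be the product of the ties of all pairs related in `I`.
Since `I * J` is the least partition of type `B` above `I` and `J`, the element `tieProd I * tieProd
J` absorbs all ties of `I * J`; hence `tieProd` is multiplicative. It is also equivariant, so `(I,
g) ↦ tieProd I * g` is a homomorphism on the semidirect product.

Conversely the defining relations hold in the tied monoid, which gives `toTied`. It sends `tie a b`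
to `ε_{a,b}`, and every `I` is the product of the `ε_{a,b}` over its related pairs, so the two
homomorphisms are mutually inverse. -/

/-- Elements `σ_0, …, σ_{n-1}` of a group acting on a set satisfy the braid relations of type `B`,
and move points `θ_0, …, θ_{n-1}` as the braid group moves the ties under conjugation. -/
structure TiedAction (n : ℕ) {G X : Type*} [Group G] [MulAction G X] (σ : ℕ → G) (θ : ℕ → X) :
    Prop where
  two_le : 2 ≤ n
  braid_zero : σ 0 * σ 1 * σ 0 * σ 1 = σ 1 * σ 0 * σ 1 * σ 0
  braid : ∀ i, 1 ≤ i → i + 1 < n → σ i * σ (i + 1) * σ i = σ (i + 1) * σ i * σ (i + 1)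
  comm : ∀ i j, i + 2 ≤ j → j < n → σ i * σ j = σ j * σ i
  fix : ∀ i j, i < n → j < n → j ≠ i + 1 → i ≠ j + 1 → σ i • θ j = θ j
  fix_zero : σ 1 • σ 0 • σ 1 • θ 0 = θ 0
  fix_one : σ 0 • σ 1 • σ 0 • θ 1 = θ 1
  sq_fix : ∀ i, i + 1 < n → σ i • σ i • θ (i + 1) = θ (i + 1)
  sq_fix' : ∀ i, i + 1 < n → σ (i + 1) • σ (i + 1) • θ i = θ i
  adj : ∀ i, 1 ≤ i → i + 1 < n → σ i • θ (i + 1) = σ (i + 1) • θ i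

/-- The image of `θ_0` indexed by the pair `{-k, k}`. -/
def zeroTie {G X : Type*} [Group G] [MulAction G X] (σ : ℕ → G) (θ : ℕ → X) : ℕ → X
  -- Absolute values of points are at least `1`; the value at `0` is a filler.
  | 0 => θ 0
  | 1 => θ 0
  | k + 2 => σ (k + 1) • zeroTie σ θ (k + 1)

/-- `θ_1`, or its image under `σ_0`. -/
def signTie {G X : Type*} [Group G] [MulAction G X] (σ : ℕ → G) (θ : ℕ → X) : Bool → X
  | true => θ 1
  | false => σ 0 • θ 1

/-- The image of `θ_1` indexed by the pair `{1, l}` or `{-1, l}`, according to the sign. -/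
def rowTie {G X : Type*} [Group G] [MulAction G X] (σ : ℕ → G) (θ : ℕ → X) (s : Bool) : ℕ → X
  -- Only `l ≥ 2` is meaningful; the values at `0` and `1` are fillers.
  | 0 => signTie σ θ s
  | 1 => signTie σ θ s
  | 2 => signTie σ θ s
  | l + 3 => σ (l + 2) • rowTie σ θ s (l + 2)

/-- The image of `θ_1` indexed by the pair `{k, l}` or `{-k, l}`, according to the sign. -/
def pairTie {G X : Type*} [Group G] [MulAction G X] (σ : ℕ → G) (θ : ℕ → X) (s : Bool) (l : ℕ) :
    ℕ → X
  -- Only `1 ≤ k < l` is meaningful; the value at `0` is a filler.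
  | 0 => rowTie σ θ s l
  | 1 => rowTie σ θ s l
  | k + 2 => σ (k + 1) • pairTie σ θ s l (k + 1)

section Families

variable {n : ℕ} {G X : Type*} [Group G] [MulAction G X] {σ : ℕ → G} {θ : ℕ → X}

theorem zeroTie_succ {k : ℕ} (hk : 1 ≤ k) : zeroTie σ θ (k + 1) = σ k • zeroTie σ θ k := by
  obtain ⟨k, rfl⟩ := Nat.exists_eq_add_of_le' hk
  rfl

theorem rowTie_succ {s : Bool} {l : ℕ} (hl : 2 ≤ l) :
    rowTie σ θ s (l + 1) = σ l • rowTie σ θ s l := by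
  obtain ⟨l, rfl⟩ := Nat.exists_eq_add_of_le' hl
  rfl

theorem pairTie_succ {s : Bool} {l k : ℕ} (hk : 1 ≤ k) :
    pairTie σ θ s l (k + 1) = σ k • pairTie σ θ s l k := by
  obtain ⟨k, rfl⟩ := Nat.exists_eq_add_of_le' hk
  rfl

namespace TiedAction

theorem comm_smul (h : TiedAction n σ θ) {i j : ℕ} (hij : i + 2 ≤ j) (hj : j < n) (x : X) :
    σ j • σ i • x = σ i • σ j • x := by
  rw [smul_smul, smul_smul, h.comm i j hij hj]

theorem braid_smul (h : TiedAction n σ θ) {i : ℕ} (hi : 1 ≤ i) (hn : i + 1 < n) (x : X) :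
    σ i • σ (i + 1) • σ i • x = σ (i + 1) • σ i • σ (i + 1) • x := by
  simp only [smul_smul, ← mul_assoc, h.braid i hi hn]

theorem braid_zero_smul (h : TiedAction n σ θ) (x : X) :
    σ 0 • σ 1 • σ 0 • σ 1 • x = σ 1 • σ 0 • σ 1 • σ 0 • x := by
  simp only [smul_smul, ← mul_assoc, h.braid_zero]

/-- If `σ_{i+1}` fixes `x` and `σ_i` has order two on `x`, then `σ_{i+1}` has order two
on `σ_i x`. -/
theorem sq_transfer (h : TiedAction n σ θ) {i : ℕ} (hi : 1 ≤ i) (hn : i + 1 < n) {x : X}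
    (hx : σ (i + 1) • x = x) (hs : σ i • σ i • x = x) :
    σ (i + 1) • σ (i + 1) • σ i • x = σ i • x := by
  calc σ (i + 1) • σ (i + 1) • σ i • x = σ (i + 1) • σ (i + 1) • σ i • σ (i + 1) • x := by rw [hx]
    _ = σ (i + 1) • σ i • σ (i + 1) • σ i • x := by rw [← h.braid_smul hi hn]
    _ = σ i • σ (i + 1) • σ i • σ i • x := by rw [← h.braid_smul hi hn]
    _ = σ i • x := by rw [hs, hx]

/-! #### The ties of the pairs `{-k, k}` -/

theorem zeroTie_fix_of_gt (h : TiedAction n σ θ) {k : ℕ} (hk : 1 ≤ k) :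
    ∀ i, k < i → i < n → σ i • zeroTie σ θ k = zeroTie σ θ k := by
  induction k, hk using Nat.le_induction with
  | base => exact fun i hi hn => h.fix i 0 hn (by omega) (by omega) (by omega)
  | succ k hk ih =>
    intro i hi hn
    rw [zeroTie_succ hk, h.comm_smul (by omega) hn, ih i (by omega) hn]

theorem zeroTie_sq (h : TiedAction n σ θ) {k : ℕ} (hk : 1 ≤ k) (hn : k < n) :
    σ k • σ k • zeroTie σ θ k = zeroTie σ θ k := by
  induction k, hk using Nat.le_induction with
  | base => exact h.sq_fix' 0 hn
  | succ k hk ih =>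
    rw [zeroTie_succ hk]
    exact h.sq_transfer hk hn (h.zeroTie_fix_of_gt hk _ (by omega) hn) (ih (by omega))

/-- The content is at `k = 2`: `fix_zero` and `zeroTie_sq` show that `σ 1` takes both sides to the
tie of `{-1, 1}`. Beyond that, `σ 0` commutes with the new factor `σ k`. -/
theorem zeroTie_fix_zero (h : TiedAction n σ θ) {k : ℕ} (hk : 1 ≤ k) (hn : k ≤ n) :
    σ 0 • zeroTie σ θ k = zeroTie σ θ k := by
  have two := h.two_le
  have h2 : σ 0 • zeroTie σ θ 2 = zeroTie σ θ 2 := by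
    have h1 := h.zeroTie_sq le_rfl (by omega)
    have h3 : σ 1 • σ 0 • σ 1 • zeroTie σ θ 1 = zeroTie σ θ 1 := h.fix_zero
    rw [zeroTie_succ le_rfl, ← smul_left_cancel_iff (σ 1), h3, h1]
  obtain rfl | hk' := hk.eq_or_lt
  · exact h.fix 0 0 (by omega) (by omega) (by omega) (by omega)
  · clear hk
    induction k, hk' using Nat.le_induction with
    | base => exact h2
    | succ k hk ih =>
      have hk' : 2 ≤ k := hk
      rw [zeroTie_succ (by omega), ← h.comm_smul (by omega) (by omega),
        ih (by omega)]

/-- At `k = i + 2` the braid relation trades the outer `σ i` for an inner `σ (i + 1)`, which acts on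
the tie of `{-i, i}` and fixes it. -/
theorem zeroTie_fix_of_lt (h : TiedAction n σ θ) {i k : ℕ} (hi : 1 ≤ i) (hk : i + 2 ≤ k)
    (hn : k ≤ n) : σ i • zeroTie σ θ k = zeroTie σ θ k := by
  induction k, hk using Nat.le_induction with
  | base =>
    rw [zeroTie_succ (by omega), zeroTie_succ hi, h.braid_smul hi (by omega),
      h.zeroTie_fix_of_gt hi _ (by omega) (by omega)]
  | succ k hk ih =>
    rw [zeroTie_succ (by omega), ← h.comm_smul (by omega) (by omega), ih (by omega)]

/-! #### The ties of the pairs `{1, l}` and `{-1, l}` -/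

theorem signTie_fix_one (h : TiedAction n σ θ) (s : Bool) :
    σ 1 • signTie σ θ s = signTie σ θ s := by
  have two := h.two_le
  have h1 : σ 1 • θ 1 = θ 1 := h.fix 1 1 (by omega) (by omega) (by omega) (by omega)
  cases s
  · change σ 1 • σ 0 • θ 1 = σ 0 • θ 1
    rw [← smul_left_cancel_iff (σ 0), h.fix_one, h.sq_fix 0 (by omega)]
  · exact h1

theorem smul_zero_signTie (h : TiedAction n σ θ) (s : Bool) :
    σ 0 • signTie σ θ s = signTie σ θ (!s) := by
  cases s
  · exact h.sq_fix 0 h.two_le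
  · rfl

theorem signTie_fix (h : TiedAction n σ θ) (s : Bool) {i : ℕ} (hi : 3 ≤ i) (hn : i < n) :
    σ i • signTie σ θ s = signTie σ θ s := by
  have h1 : σ i • θ 1 = θ 1 := h.fix i 1 hn (by omega) (by omega) (by omega)
  cases s
  · change σ i • σ 0 • θ 1 = σ 0 • θ 1
    rw [h.comm_smul (by omega) hn, h1]
  · exact h1

theorem signTie_sq (h : TiedAction n σ θ) (s : Bool) (hn : 2 < n) :
    σ 2 • σ 2 • signTie σ θ s = signTie σ θ s := by
  have h1 : σ 2 • σ 2 • θ 1 = θ 1 := h.sq_fix' 1 hn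
  cases s
  · change σ 2 • σ 2 • σ 0 • θ 1 = σ 0 • θ 1
    rw [h.comm_smul (i := 0) (by omega) hn, h.comm_smul (i := 0) (by omega) hn, h1]
  · exact h1

/-- Here `σ 0 • σ 1 • θ 2` stands for the pair `{-1, 3}` and `σ 1 • σ 0 • σ 1 • θ 2` for `{-2, 3}`.
As `σ 0` fixes `θ 2`, it can be inserted to complete a word for the braid relation of length four.
-/
theorem smul_zero_smul_one_theta_two (h : TiedAction n σ θ) (hn : 2 < n) :
    σ 1 • σ 1 • σ 0 • σ 1 • θ 2 = σ 0 • σ 1 • θ 2 ∧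
    σ 0 • σ 1 • σ 0 • σ 1 • θ 2 = σ 1 • σ 0 • σ 1 • θ 2 := by
  have h0 : σ 0 • θ 2 = θ 2 := h.fix 0 2 (by omega) hn (by omega) (by omega)
  have h1 : σ 1 • σ 1 • θ 2 = θ 2 := h.sq_fix 1 hn
  refine ⟨?_, by rw [h.braid_zero_smul, h0]⟩
  calc σ 1 • σ 1 • σ 0 • σ 1 • θ 2 = σ 1 • σ 1 • σ 0 • σ 1 • σ 0 • θ 2 := by rw [h0]
    _ = σ 0 • σ 1 • σ 0 • σ 1 • σ 1 • θ 2 := by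
      rw [← h.braid_zero_smul, ← h.braid_zero_smul]
    _ = σ 0 • σ 1 • θ 2 := by rw [h1, h0]

theorem rowTie_three_sq (h : TiedAction n σ θ) (s : Bool) (hn : 2 < n) :
    σ 1 • σ 1 • rowTie σ θ s 3 = rowTie σ θ s 3 := by
  -- `σ 1` and `σ 2` do not commute, so the tie of `{1, 3}` is rewritten as an image of `θ 2`, on
  -- which the known relations apply.
  have h1 : σ 1 • θ 2 = σ 2 • θ 1 := h.adj 1 le_rfl hn
  cases s
  · change σ 1 • σ 1 • σ 2 • σ 0 • θ 1 = σ 2 • σ 0 • θ 1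
    rw [h.comm_smul (by omega) hn, ← h1, (h.smul_zero_smul_one_theta_two hn).1]
  · change σ 1 • σ 1 • σ 2 • θ 1 = σ 2 • θ 1
    rw [← h1, h.sq_fix 1 hn]

theorem rowTie_three_fix_zero (h : TiedAction n σ θ) (s : Bool) (hn : 2 < n) :
    σ 0 • σ 1 • rowTie σ θ s 3 = σ 1 • rowTie σ θ s 3 := by
  have h1 : σ 1 • θ 2 = σ 2 • θ 1 := h.adj 1 le_rfl hn
  cases s
  · change σ 0 • σ 1 • σ 2 • σ 0 • θ 1 = σ 1 • σ 2 • σ 0 • θ 1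
    rw [h.comm_smul (by omega) hn, ← h1, (h.smul_zero_smul_one_theta_two hn).2]
  · change σ 0 • σ 1 • σ 2 • θ 1 = σ 1 • σ 2 • θ 1
    rw [← h1, h.sq_fix 1 hn, h.fix 0 2 (by omega) hn (by omega) (by omega)]

theorem smul_zero_rowTie (h : TiedAction n σ θ) {s : Bool} {l : ℕ} (hl : 2 ≤ l) (hn : l ≤ n) :
    σ 0 • rowTie σ θ s l = rowTie σ θ (!s) l := by
  induction l, hl using Nat.le_induction with
  | base => exact h.smul_zero_signTie s
  | succ l hl ih =>
    rw [rowTie_succ hl, rowTie_succ hl, ← h.comm_smul (by omega) (by omega), ih (by omega)]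

theorem rowTie_fix_of_gt (h : TiedAction n σ θ) {s : Bool} {l : ℕ} (hl : 2 ≤ l) :
    ∀ i, l < i → i < n → σ i • rowTie σ θ s l = rowTie σ θ s l := by
  induction l, hl using Nat.le_induction with
  | base => exact fun i hi hn => h.signTie_fix s hi hn
  | succ l hl ih =>
    intro i hi hn
    rw [rowTie_succ hl, h.comm_smul (by omega) hn, ih i (by omega) hn]

theorem rowTie_sq (h : TiedAction n σ θ) {s : Bool} {l : ℕ} (hl : 2 ≤ l) (hn : l < n) :
    σ l • σ l • rowTie σ θ s l = rowTie σ θ s l := by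
  induction l, hl using Nat.le_induction with
  | base => exact h.signTie_sq s hn
  | succ l hl ih =>
    rw [rowTie_succ hl]
    exact h.sq_transfer (by omega) hn (h.rowTie_fix_of_gt hl _ (by omega) hn) (ih (by omega))

theorem rowTie_fix_of_lt (h : TiedAction n σ θ) {s : Bool} {i l : ℕ} (hi : 2 ≤ i)
    (hl : i + 2 ≤ l) (hn : l ≤ n) : σ i • rowTie σ θ s l = rowTie σ θ s l := by
  induction l, hl using Nat.le_induction with
  | base =>
    rw [rowTie_succ (by omega), rowTie_succ hi, h.braid_smul (by omega) (by omega),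
      h.rowTie_fix_of_gt hi _ (by omega) (by omega)]
  | succ l hl ih =>
    rw [rowTie_succ (by omega), ← h.comm_smul (by omega) (by omega), ih (by omega)]

theorem rowTie_sq_one (h : TiedAction n σ θ) {s : Bool} {l : ℕ} (hl : 3 ≤ l) (hn : l ≤ n) :
    σ 1 • σ 1 • rowTie σ θ s l = rowTie σ θ s l := by
  induction l, hl using Nat.le_induction with
  | base => exact h.rowTie_three_sq s hn
  | succ l hl ih =>
    rw [rowTie_succ (by omega), ← h.comm_smul (i := 1) (j := l) (by omega) (by omega),
      ← h.comm_smul (i := 1) (by omega) (by omega), ih (by omega)]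

theorem smul_one_rowTie_fix_zero (h : TiedAction n σ θ) {s : Bool} {l : ℕ} (hl : 3 ≤ l)
    (hn : l ≤ n) : σ 0 • σ 1 • rowTie σ θ s l = σ 1 • rowTie σ θ s l := by
  induction l, hl using Nat.le_induction with
  | base => exact h.rowTie_three_fix_zero s hn
  | succ l hl ih =>
    rw [rowTie_succ (by omega), ← h.comm_smul (i := 1) (by omega) (by omega),
      ← h.comm_smul (i := 0) (by omega) (by omega), ih (by omega)]

/-! #### The ties of the pairs `{k, l}` and `{-k, l}` -/

theorem pairTie_fix_of_gt (h : TiedAction n σ θ) {s : Bool} {k l i : ℕ} (hk : 1 ≤ k)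
    (hkl : k < l) (hl : l < i) (hn : i < n) :
    σ i • pairTie σ θ s l k = pairTie σ θ s l k := by
  induction k, hk using Nat.le_induction with
  | base => exact h.rowTie_fix_of_gt hkl i hl hn
  | succ k hk ih => rw [pairTie_succ hk, h.comm_smul (by omega) hn, ih (by omega)]

theorem smul_pairTie_top (h : TiedAction n σ θ) {s : Bool} {k l : ℕ} (hk : 1 ≤ k)
    (hkl : k < l) (hn : l < n) :
    σ l • pairTie σ θ s l k = pairTie σ θ s (l + 1) k := by
  induction k, hk using Nat.le_induction with
  | base => exact (rowTie_succ hkl).symm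
  | succ k hk ih =>
    rw [pairTie_succ hk, pairTie_succ hk, h.comm_smul (by omega) hn, ih (by omega)]

theorem smul_pairTie_top_succ (h : TiedAction n σ θ) {s : Bool} {k l : ℕ} (hk : 1 ≤ k)
    (hkl : k < l) (hn : l < n) :
    σ l • pairTie σ θ s (l + 1) k = pairTie σ θ s l k := by
  induction k, hk using Nat.le_induction with
  | base =>
    change σ l • rowTie σ θ s (l + 1) = rowTie σ θ s l
    rw [rowTie_succ hkl, h.rowTie_sq hkl hn]
  | succ k hk ih =>
    rw [pairTie_succ hk, pairTie_succ hk, h.comm_smul (by omega) hn, ih (by omega)]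

/-- In the induction the pair `{k + 1, k + 2}` is reached from `{k, k + 1}` by `σ k * σ (k + 1)`,
and the braid relation passes `σ (k + 1)` through this word as `σ k`. -/
theorem smul_pairTie_adj (h : TiedAction n σ θ) {s : Bool} {k : ℕ} (hk : 1 ≤ k) (hn : k < n) :
    σ k • pairTie σ θ s (k + 1) k = pairTie σ θ s (k + 1) k := by
  induction k, hk using Nat.le_induction with
  | base => exact h.signTie_fix_one s
  | succ k hk ih =>
    rw [pairTie_succ hk, ← h.smul_pairTie_top hk (by omega) hn, ← h.braid_smul hk hn,
      ih (by omega)]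

theorem pairTie_fix_of_mid (h : TiedAction n σ θ) {s : Bool} {k l i : ℕ} (hk : 1 ≤ k)
    (hki : k < i) (hil : i + 2 ≤ l) (hn : l ≤ n) :
    σ i • pairTie σ θ s l k = pairTie σ θ s l k := by
  induction k, hk using Nat.le_induction with
  | base => exact h.rowTie_fix_of_lt hki hil hn
  | succ k hk ih => rw [pairTie_succ hk, h.comm_smul (by omega) (by omega), ih (by omega)]

theorem pairTie_sq (h : TiedAction n σ θ) {s : Bool} {k l : ℕ} (hk : 1 ≤ k)
    (hkl : k + 2 ≤ l) (hn : l ≤ n) :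
    σ k • σ k • pairTie σ θ s l k = pairTie σ θ s l k := by
  induction k, hk using Nat.le_induction with
  | base => exact h.rowTie_sq_one hkl hn
  | succ k hk ih =>
    rw [pairTie_succ hk]
    exact h.sq_transfer hk (by omega) (h.pairTie_fix_of_mid hk (by omega) (by omega) hn)
      (ih (by omega))

theorem pairTie_fix_of_lt (h : TiedAction n σ θ) {s : Bool} {k l i : ℕ} (hi : 1 ≤ i)
    (hik : i + 2 ≤ k) (hkl : k < l) (hn : l ≤ n) :
    σ i • pairTie σ θ s l k = pairTie σ θ s l k := by
  induction k, hik using Nat.le_induction with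
  | base =>
    rw [pairTie_succ (by omega), pairTie_succ hi, h.braid_smul hi (by omega),
      h.pairTie_fix_of_mid hi (by omega) (by omega) (by omega)]
  | succ k hk ih =>
    rw [pairTie_succ (by omega), ← h.comm_smul (by omega) (by omega), ih (by omega)]

theorem pairTie_fix_zero (h : TiedAction n σ θ) {s : Bool} {k l : ℕ} (hk : 2 ≤ k)
    (hkl : k < l) (hn : l ≤ n) : σ 0 • pairTie σ θ s l k = pairTie σ θ s l k := by
  induction k, hk using Nat.le_induction with
  | base => exact h.smul_one_rowTie_fix_zero hkl hn
  | succ k hk ih =>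
    rw [pairTie_succ (by omega), ← h.comm_smul (by omega) (by omega), ih (by omega)]

end TiedAction
end Families
/-! ### Signed permutations and absolute values -/

theorem tPerm_natAbs {n : ℕ} {i : Fin n} (hi : i.1 ≠ 0) (x : PM n) :
    (0 < (tPerm i x).1 ↔ 0 < x.1) ∧
    ((x.1.natAbs = i ∧ (tPerm i x).1.natAbs = i + 1) ∨
      (x.1.natAbs = i + 1 ∧ (tPerm i x).1.natAbs = i) ∨
      (x.1.natAbs ≠ i ∧ x.1.natAbs ≠ i + 1 ∧ (tPerm i x).1.natAbs = x.1.natAbs)) := by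
  rcases tPerm_spec i hi x with h | h | h | h | h <;> omega

theorem tPerm_zero_natAbs {n : ℕ} {i : Fin n} (hi : i.1 = 0) (x : PM n) :
    (tPerm i x).1.natAbs = x.1.natAbs ∧
    (x.1.natAbs = 1 → (0 < (tPerm i x).1 ↔ ¬ 0 < x.1)) ∧
    (x.1.natAbs ≠ 1 → (0 < (tPerm i x).1 ↔ 0 < x.1)) := by
  rcases tPerm_spec_zero i hi x with h | h | h <;> omega

theorem PM.natAbs_pos {n : ℕ} (x : PM n) : 1 ≤ x.1.natAbs := by
  have := x.2.1
  omega

theorem PM.natAbs_le {n : ℕ} (x : PM n) : x.1.natAbs ≤ n := by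
  have h1 := x.2.2
  have h2 := Int.natCast_natAbs x.1
  omega

/-- The sign of an element of `[±n]`, as a truth value. -/
def PM.sgn {n : ℕ} (x : PM n) : Bool := decide (0 < x.1)

theorem PM.sgn_eq_iff {n : ℕ} {x y : PM n} : x.sgn = y.sgn ↔ (0 < x.1 ↔ 0 < y.1) :=
  decide_eq_decide

theorem PM.sgn_eq_not_iff {n : ℕ} {x y : PM n} : x.sgn = !y.sgn ↔ (0 < x.1 ↔ ¬ 0 < y.1) := by
  rw [PM.sgn, PM.sgn, ← decide_not, decide_eq_decide]

/-- The tie of the pair `{a, b}`; it only depends on the class of `{a, b}` up to sign. -/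
def tieAt {n : ℕ} {G X : Type*} [Group G] [MulAction G X] (σ : ℕ → G) (θ : ℕ → X) (a b : PM n) :
    X :=
  -- Equal arguments `a, a` also receive the tie of `{-a, a}`; only distinct points are meaningful.
  if a.1.natAbs = b.1.natAbs then zeroTie σ θ a.1.natAbs
  else pairTie σ θ (a.sgn == b.sgn) (max a.1.natAbs b.1.natAbs)
    (min a.1.natAbs b.1.natAbs)

section Families

variable {n : ℕ} {G X : Type*} [Group G] [MulAction G X] {σ : ℕ → G} {θ : ℕ → X}

theorem tieAt_comm (a b : PM n) : tieAt σ θ a b = tieAt σ θ b a := by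
  unfold tieAt
  by_cases h : a.1.natAbs = b.1.natAbs
  · rw [if_pos h, if_pos h.symm, h]
  · rw [if_neg h, if_neg (Ne.symm h), max_comm, min_comm, Bool.beq_comm]

theorem tieAt_of_lt {a b : PM n} (h : a.1.natAbs < b.1.natAbs) :
    tieAt σ θ a b =
      pairTie σ θ (a.sgn == b.sgn) b.1.natAbs a.1.natAbs := by
  rw [tieAt, if_neg h.ne, max_eq_right h.le, min_eq_left h.le]

theorem tieAt_neg_neg (a b : PM n) : tieAt σ θ (-a) (-b) = tieAt σ θ a b := by
  have ha := a.2.1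
  have hb := b.2.1
  have h1 : ((-a).sgn == (-b).sgn) = (a.sgn == b.sgn) := by
    rw [Bool.eq_iff_iff, beq_iff_eq, beq_iff_eq, PM.sgn_eq_iff, PM.sgn_eq_iff, PM.val_neg,
      PM.val_neg]
    omega
  simp only [tieAt, PM.val_neg, Int.natAbs_neg, h1]

namespace TiedAction

theorem smul_zeroTie (h : TiedAction n σ θ) (i : Fin n) (x : PM n) :
    σ i • zeroTie σ θ x.1.natAbs = zeroTie σ θ (tPerm i x).1.natAbs := by
  have hx := x.natAbs_pos
  have hn := x.natAbs_le
  have hi := i.2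
  by_cases h0 : i.1 = 0
  · rw [(tPerm_zero_natAbs h0 x).1, h0]
    exact h.zeroTie_fix_zero hx hn
  · obtain ⟨-, ⟨h1, h2⟩ | ⟨h1, h2⟩ | ⟨h1, h2, h3⟩⟩ := tPerm_natAbs h0 x
    · rw [h1, h2, zeroTie_succ (by omega)]
    · rw [h1, h2, zeroTie_succ (by omega), h.zeroTie_sq (by omega) hi]
    · rw [h3]
      rcases lt_or_gt_of_ne h1 with h4 | h4
      · exact h.zeroTie_fix_of_gt hx _ h4 hi
      · exact h.zeroTie_fix_of_lt (by omega) (by omega) hn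

theorem smul_tieAt_of_lt (h : TiedAction n σ θ) (i : Fin n) {a b : PM n}
    (hab : a.1.natAbs < b.1.natAbs) :
    σ i • tieAt σ θ a b = tieAt σ θ (tPerm i a) (tPerm i b) := by
  have ha := a.natAbs_pos
  have hn := b.natAbs_le
  have hi := i.2
  rw [tieAt_of_lt hab]
  by_cases h0 : i.1 = 0
  · obtain ⟨h1, h2, h3⟩ := tPerm_zero_natAbs h0 a
    obtain ⟨h4, -, h6⟩ := tPerm_zero_natAbs h0 b
    rw [tieAt_of_lt (by omega), h1, h4, h0, PM.sgn_eq_iff.2 (h6 (by omega))]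
    by_cases ha1 : a.1.natAbs = 1
    · rw [ha1]
      have hs : ∀ x y : Bool, ((!x) == y) = !(x == y) := by decide
      rw [PM.sgn_eq_not_iff.2 (h2 ha1), hs]
      exact h.smul_zero_rowTie (by omega) hn
    · rw [PM.sgn_eq_iff.2 (h3 ha1)]
      exact h.pairTie_fix_zero (by omega) hab hn
  · obtain ⟨h1, h2⟩ := tPerm_natAbs h0 a
    obtain ⟨h3, h4⟩ := tPerm_natAbs h0 b
    -- This is the only case in which `tPerm i` reverses the order of the absolute values.
    by_cases hadj : a.1.natAbs = i ∧ b.1.natAbs = i + 1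
    · rw [tieAt_comm, tieAt_of_lt (by omega), PM.sgn_eq_iff.2 h1, PM.sgn_eq_iff.2 h3,
        Bool.beq_comm, show (tPerm i a).1.natAbs = i + 1 by omega,
        show (tPerm i b).1.natAbs = i by omega, hadj.1, hadj.2, h.smul_pairTie_adj (by omega) hi]
    · have hlt : (tPerm i a).1.natAbs < (tPerm i b).1.natAbs := by omega
      rw [tieAt_of_lt hlt, PM.sgn_eq_iff.2 h1, PM.sgn_eq_iff.2 h3]
      rcases h2 with ⟨h5, h6⟩ | ⟨h5, h6⟩ | ⟨h5, h6, h7⟩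
      · have hb : (tPerm i b).1.natAbs = b.1.natAbs := by omega
        rw [h5, h6, hb, pairTie_succ (by omega)]
      · have hb : (tPerm i b).1.natAbs = b.1.natAbs := by omega
        rw [h5, h6, hb, pairTie_succ (by omega),
          h.pairTie_sq (by omega) (by omega) hn]
      · rw [h7]
        rcases h4 with ⟨h8, h9⟩ | ⟨h8, h9⟩ | ⟨h8, h9, h10⟩
        · rw [h8, h9, h.smul_pairTie_top ha (by omega) hi]
        · rw [h8, h9, h.smul_pairTie_top_succ ha (by omega) hi]
        · rw [h10]
          rcases lt_or_gt_of_ne h8 with h11 | h11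
          · exact h.pairTie_fix_of_gt ha hab h11 hi
          · rcases lt_or_gt_of_ne h5 with h12 | h12
            · exact h.pairTie_fix_of_mid ha h12 (by omega) hn
            · exact h.pairTie_fix_of_lt (by omega) (by omega) hab hn

theorem smul_tieAt (h : TiedAction n σ θ) (i : Fin n) (a b : PM n) :
    σ i • tieAt σ θ a b = tieAt σ θ (tPerm i a) (tPerm i b) := by
  rcases lt_trichotomy a.1.natAbs b.1.natAbs with hab | hab | hab
  · exact h.smul_tieAt_of_lt i hab
  · have hab' : (tPerm i a).1.natAbs = (tPerm i b).1.natAbs := by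
      by_cases h0 : i.1 = 0
      · have h1 := tPerm_zero_natAbs h0 a
        have h2 := tPerm_zero_natAbs h0 b
        omega
      · have h1 := tPerm_natAbs h0 a
        have h2 := tPerm_natAbs h0 b
        omega
    rw [tieAt, if_pos hab, tieAt, if_pos hab', h.smul_zeroTie]
  · rw [tieAt_comm, h.smul_tieAt_of_lt i hab, tieAt_comm]

/-- This identifies the given `θ k` with members of the family, which is built from `θ 0` and `θ 1`
alone; `adj` and `sq_fix` carry the induction. -/
theorem pairTie_adj_eq (h : TiedAction n σ θ) {k : ℕ} (hk : 1 ≤ k) (hn : k < n) :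
    pairTie σ θ true (k + 1) k = θ k := by
  induction k, hk using Nat.le_induction with
  | base => rfl
  | succ k hk ih =>
    rw [pairTie_succ hk, ← h.smul_pairTie_top hk (by omega) hn, ih (by omega),
      ← h.adj k hk hn, h.sq_fix k hn]

end TiedAction
end Families

/-! ### The braid group acts on ties through signed permutations -/

theorem proj_braidGen {n : ℕ} (i : Fin n) : proj n (braidGen i) = t i :=
  PresentedGroup.toGroup.of _

theorem braidGen_induction {n : ℕ} {p : BraidB n → Prop} (g : BraidB n) (one : p 1)
    (gen : ∀ i, p (braidGen i)) (mul : ∀ x y, p x → p y → p (x * y)) (inv : ∀ x, p x → p x⁻¹) :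
    p g := by
  have hg : g ∈ Subgroup.closure (Set.range (PresentedGroup.of (rels := {r | BraidRel n r}))) := by
    rw [PresentedGroup.closure_range_of]
    trivial
  induction hg using Subgroup.closure_induction with
  | mem x hx => obtain ⟨i, rfl⟩ := hx; exact gen i
  | one => exact one
  | mul x y _ _ hx hy => exact mul x y hx hy
  | inv x _ hx => exact inv x hx

theorem TiedAction.braid_smul_tieAt {n : ℕ} {G X : Type*} [Group G] [MulAction G X] {σ : ℕ → G}
    {θ : ℕ → X} (h : TiedAction n σ θ) (c : BraidB n →* G) (hc : ∀ i : Fin n, c (braidGen i) = σ i)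
    (g : BraidB n) : ∀ a b : PM n,
      c g • tieAt σ θ a b = tieAt σ θ ((proj n g).1 a) ((proj n g).1 b) := by
  induction g using braidGen_induction with
  | one => simp
  | gen i =>
    intro a b
    rw [hc, proj_braidGen, h.smul_tieAt]
    rfl
  | mul x y hx hy =>
    intro a b
    rw [map_mul, mul_smul, hy, hx, map_mul]
    rfl
  | inv x hx =>
    intro a b
    rw [map_inv, inv_smul_eq_iff, hx, ← Equiv.Perm.mul_apply, ← Equiv.Perm.mul_apply,
      ← Subgroup.coe_mul, ← map_mul, mul_inv_cancel]
    simp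

/-! ### Transitivity of the braid group on tuples -/

theorem proj_mul_apply {n : ℕ} (g h : BraidB n) (x : PM n) :
    (proj n (g * h)).1 x = (proj n g).1 ((proj n h).1 x) := by
  rw [map_mul]
  rfl

theorem proj_braidGen_apply {n : ℕ} (i : Fin n) (x : PM n) :
    (proj n (braidGen i)).1 x = tPerm i x := by
  rw [proj_braidGen]
  rfl

theorem exists_braid_flip {n : ℕ} (k : ℕ) (hk : k < n) : ∃ g : BraidB n,
    ∀ x : PM n, (x.1.natAbs = k + 1 → (proj n g).1 x = -x) ∧
      (x.1.natAbs ≠ k + 1 → (proj n g).1 x = x) := by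
  induction k with
  | zero =>
    refine ⟨braidGen ⟨0, hk⟩, fun x => ?_⟩
    rw [proj_braidGen_apply]
    have hs := tPerm_spec_zero ⟨0, hk⟩ rfl x
    constructor <;> intro hx <;> apply PM.ext <;> (try rw [PM.val_neg]) <;> omega
  | succ k ih =>
    obtain ⟨g, hg⟩ := ih (by omega)
    -- The sign change of `k + 2` is the conjugate of that of `k + 1` by the transposition
    -- exchanging the two.
    refine ⟨braidGen ⟨k + 1, hk⟩ * g * braidGen ⟨k + 1, hk⟩, fun x => ?_⟩
    rw [proj_mul_apply, proj_mul_apply, proj_braidGen_apply, proj_braidGen_apply]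
    have h1 := tPerm_spec ⟨k + 1, hk⟩ (by simp) x
    have h2 := hg (tPerm ⟨k + 1, hk⟩ x)
    have h3 := tPerm_spec ⟨k + 1, hk⟩ (by simp) ((proj n g).1 (tPerm ⟨k + 1, hk⟩ x))
    simp only at h1 h3
    push_cast at h1 h3
    constructor <;> intro hx <;> apply PM.ext
    · have h4 := congrArg Subtype.val (h2.1 (by omega))
      simp only [PM.val_neg] at h4 ⊢
      omega
    · have h4 := congrArg Subtype.val (h2.2 (by omega))
      omega

theorem exists_braid_raise {n : ℕ} (k : Fin n) (m : ℕ) (hk : k.1 + 1 ≤ m) (hm : m ≤ n) :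
    ∃ g : BraidB n, (((proj n g).1 (pos k)).1 = m) ∧
      ∀ x : PM n, x.1.natAbs ≤ k → (proj n g).1 x = x := by
  induction m, hk using Nat.le_induction with
  | base => exact ⟨1, by simp, fun x _ => by simp⟩
  | succ m hk ih =>
    obtain ⟨g, h1, h2⟩ := ih (by omega)
    refine ⟨braidGen ⟨m, hm⟩ * g, ?_, fun x hx => ?_⟩
    · rw [proj_mul_apply, proj_braidGen_apply]
      have h3 := tPerm_spec ⟨m, hm⟩ (by simp only; omega) ((proj n g).1 (pos k))
      simp only at h3
      push_cast
      omega
    · rw [proj_mul_apply, proj_braidGen_apply, h2 x hx]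
      have h3 := tPerm_spec ⟨m, hm⟩ (by simp only; omega) x
      simp only at h3
      apply PM.ext
      omega

theorem exists_braid_move {n : ℕ} (k : Fin n) (b : PM n) (hb : k.1 < b.1.natAbs) :
    ∃ g : BraidB n, (proj n g).1 (pos k) = b ∧
      ∀ x : PM n, x.1.natAbs ≤ k → (proj n g).1 x = x := by
  obtain ⟨g, h1, h2⟩ := exists_braid_raise k b.1.natAbs hb b.natAbs_le
  by_cases h0 : 0 < b.1
  · exact ⟨g, PM.ext (by omega), h2⟩
  · obtain ⟨f, hf⟩ := exists_braid_flip k.1 k.2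
    refine ⟨g * f, ?_, fun x hx => ?_⟩
    · rw [proj_mul_apply, (hf _).1 (by rw [pos_val]; omega), SignedPerm.map_neg]
      apply PM.ext
      rw [PM.val_neg]
      omega
    · rw [proj_mul_apply, (hf x).2 (by omega), h2 x hx]

theorem PM.natAbs_eq_natAbs_iff {n : ℕ} {x y : PM n} :
    x.1.natAbs = y.1.natAbs ↔ x = y ∨ x = -y := by
  rw [Int.natAbs_eq_natAbs_iff]
  exact or_congr ⟨PM.ext, fun h => h ▸ rfl⟩ ⟨fun h => PM.ext h, fun h => h ▸ rfl⟩

theorem SignedPerm.natAbs_eq_iff {n : ℕ} (g : SignedPerm n) (x y : PM n) :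
    (g.1 x).1.natAbs = (g.1 y).1.natAbs ↔ x.1.natAbs = y.1.natAbs := by
  rw [PM.natAbs_eq_natAbs_iff, PM.natAbs_eq_natAbs_iff, ← SignedPerm.map_neg, g.1.injective.eq_iff,
    g.1.injective.eq_iff]

/-- The braid group moves `1, …, k` to any `k` points with distinct absolute values. -/
theorem exists_braid_tuple {n : ℕ} (k : ℕ) (hk : k ≤ n) (a : Fin k → PM n)
    (ha : Function.Injective fun j => (a j).1.natAbs) :
    ∃ g : BraidB n, ∀ (j : Fin k) (i : Fin n), i.1 = j.1 → (proj n g).1 (pos i) = a j := by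
  induction k with
  | zero => exact ⟨1, fun j => j.elim0⟩
  | succ k ih =>
    obtain ⟨g, hg⟩ := ih (by omega) (fun j => a j.castSucc)
      (fun i j hij => Fin.castSucc_injective _ (ha hij))
    have hb : ((proj n g).1 ((proj n g)⁻¹.1 (a (Fin.last k)))) = a (Fin.last k) :=
      (proj n g).1.apply_symm_apply _
    set b := (proj n g)⁻¹.1 (a (Fin.last k)) with hbdef
    -- If `b` had absolute value at most `k`, then `g` would send it to a point already placed, up
    -- to sign, against the injectivity of `ha`.
    obtain ⟨f, hf, hf'⟩ := exists_braid_move ⟨k, hk⟩ b (by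
      by_contra hlt
      have hb1 := b.natAbs_pos
      simp only [not_lt] at hlt
      have h1 := hg ⟨b.1.natAbs - 1, by omega⟩ ⟨b.1.natAbs - 1, by omega⟩ rfl
      have h2 : (pos (⟨b.1.natAbs - 1, by omega⟩ : Fin n)).1.natAbs = b.1.natAbs := by
        rw [pos_val]
        simp only
        omega
      rw [← SignedPerm.natAbs_eq_iff (proj n g), h1, hb] at h2
      have h3 := congrArg Fin.val (ha h2)
      simp only [Fin.val_castSucc, Fin.val_last] at h3
      omega)
    refine ⟨g * f, fun j i hij => ?_⟩
    rw [proj_mul_apply]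
    rcases Fin.eq_castSucc_or_eq_last j with ⟨j, rfl⟩ | rfl
    · rw [hf' _ (by rw [pos_val]; have := j.2; simp only [Fin.val_castSucc] at hij ⊢; omega)]
      exact hg j i hij
    · obtain rfl : i = ⟨k, hk⟩ := Fin.ext hij
      rw [hf, hb]

/-! ### Conjugation in the presented monoid -/

/-- The units of a monoid act on it by conjugation. -/
def unitsConj (M : Type*) [Monoid M] : Mˣ →* MulAut M where
  toFun u :=
    { toFun := fun x => u * x * ↑u⁻¹
      invFun := fun x => ↑u⁻¹ * x * u
      left_inv := fun x => by simp [mul_assoc]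
      right_inv := fun x => by simp [mul_assoc]
      map_mul' := fun x y => by simp [mul_assoc] }
  map_one' := by ext x; simp
  map_mul' u v := by ext x; simp [mul_assoc]

theorem unitsConj_smul_def {M : Type*} [Monoid M] (u : Mˣ) (x : M) :
    unitsConj M u • x = u * x * ↑u⁻¹ := rfl

theorem unitsConj_smul_eq_iff {M : Type*} [Monoid M] (u : Mˣ) (x y : M) :
    unitsConj M u • x = y ↔ u * x = y * u := by
  rw [unitsConj_smul_def]
  exact ⟨fun h => by rw [← h]; simp [mul_assoc], fun h => by rw [h]; simp [mul_assoc]⟩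

theorem mk_eq_of_rel {n : ℕ} {x y : FreeMonoid (Gen n)} (h : TiedRel n x y) :
    PresentedMonoid.mk (TiedRel n) x = PresentedMonoid.mk (TiedRel n) y :=
  PresentedMonoid.mk_eq_mk_of_rel h

/-- The generator `σ_i` of the presented monoid, as a unit. -/
def sigmaUnit {n : ℕ} (i : Fin n) : (Presented n)ˣ where
  val := PresentedMonoid.of _ (.sigma i)
  inv := PresentedMonoid.of _ (.sigmaInv i)
  val_inv := mk_eq_of_rel (.bb0_right i)
  inv_val := mk_eq_of_rel (.bb0_left i)

/-- The generator `θ_i` of the presented monoid. -/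
def thetaGen {n : ℕ} (i : Fin n) : Presented n := PresentedMonoid.of _ (.theta i)

theorem sigmaUnit_rel {n : ℕ} (r : FreeGroup (Fin n)) (hr : r ∈ {r | BraidRel n r}) :
    FreeGroup.lift (sigmaUnit (n := n)) r = 1 := by
  cases hr with
  | bb1 i j hi hj =>
    simp only [map_mul, map_inv, FreeGroup.lift_apply_of, mul_inv_eq_one]
    exact Units.ext (mk_eq_of_rel (.bb1 i j hi hj))
  | bb2 i j hi hj hij =>
    simp only [map_mul, map_inv, FreeGroup.lift_apply_of, mul_inv_eq_one]
    exact Units.ext (mk_eq_of_rel (.bb2 i j hi hj hij))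
  | bb3 i j hij =>
    simp only [map_mul, map_inv, FreeGroup.lift_apply_of, mul_inv_eq_one]
    exact Units.ext (mk_eq_of_rel (.bb3 i j hij))

/-- The homomorphism from the braid group to the units of the presented monoid. -/
def braidUnit (n : ℕ) : BraidB n →* (Presented n)ˣ :=
  PresentedGroup.toGroup (f := sigmaUnit) sigmaUnit_rel

theorem braidUnit_braidGen {n : ℕ} (i : Fin n) : braidUnit n (braidGen i) = sigmaUnit i :=
  PresentedGroup.toGroup.of _

/-- The braid group acts on the presented monoid by conjugation. -/
def braidConj (n : ℕ) : BraidB n →* MulAut (Presented n) :=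
  (unitsConj (Presented n)).comp (braidUnit n)

theorem braidConj_smul {n : ℕ} (g : BraidB n) (x : Presented n) :
    braidConj n g • x = braidUnit n g * x * ↑(braidUnit n g)⁻¹ := rfl

/-- Conjugation by the generator `σ_i`. -/
def conjGen (n : ℕ) (i : ℕ) : MulAut (Presented n) :=
  -- `TiedAction` is indexed by `ℕ`; the value out of range plays no role.
  if h : i < n then unitsConj _ (sigmaUnit ⟨i, h⟩) else 1

/-- The generator `θ_i`, indexed by natural numbers. -/
def thetaNat (n : ℕ) (i : ℕ) : Presented n := if h : i < n then thetaGen ⟨i, h⟩ else 1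

theorem conjGen_of_lt {n i : ℕ} (h : i < n) :
    conjGen n i = unitsConj _ (sigmaUnit ⟨i, h⟩) := dif_pos h

theorem thetaNat_of_lt {n i : ℕ} (h : i < n) : thetaNat n i = thetaGen ⟨i, h⟩ := dif_pos h

theorem braidConj_braidGen {n : ℕ} (i : Fin n) : braidConj n (braidGen i) = conjGen n i := by
  rw [conjGen_of_lt i.2]
  exact congrArg (unitsConj _) (braidUnit_braidGen i)

theorem conjGen_smul_smul_adj {n i j : ℕ} (hi : 1 ≤ i) (hj : 1 ≤ j) (hin : i < n) (hjn : j < n)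
    (hij : |(i : ℤ) - j| = 1) :
    conjGen n i • conjGen n j • thetaNat n i = thetaNat n j ∧
    conjGen n i • (conjGen n j)⁻¹ • thetaNat n i = thetaNat n j := by
  rw [conjGen_of_lt hin, conjGen_of_lt hjn, thetaNat_of_lt hin, thetaNat_of_lt hjn, ← map_inv,
    smul_smul, smul_smul, ← map_mul, ← map_mul, unitsConj_smul_eq_iff, unitsConj_smul_eq_iff]
  refine ⟨?_, ?_⟩
  · rw [Units.val_mul, ← mul_assoc]
    exact mk_eq_of_rel (.tb4 ⟨i, hin⟩ ⟨j, hjn⟩ hi hj hij)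
  · rw [Units.val_mul, ← mul_assoc]
    exact mk_eq_of_rel (.tb9 ⟨i, hin⟩ ⟨j, hjn⟩ hi hj hij)

/-- For positive indices, `tb4` and `tb9` give the same value with `σ_i` and with `σ_i⁻¹`, so both
conjugate `θ_j` to the same element. For the indices `0` and `1` this is `tb8_zero` and `tb8_one`.
-/
theorem conjGen_sq_smul {n i j : ℕ} (hin : i < n) (hjn : j < n) (hij : |(i : ℤ) - j| = 1) :
    conjGen n i • conjGen n i • thetaNat n j = thetaNat n j := by
  by_cases h : 1 ≤ i ∧ 1 ≤ j
  · obtain ⟨h1, h2⟩ := conjGen_smul_smul_adj h.2 h.1 hjn hin (by rw [abs_sub_comm]; exact hij)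
    rw [← h2, smul_left_cancel_iff] at h1
    rw [h1, smul_inv_smul]
  · rw [conjGen_of_lt hin, thetaNat_of_lt hjn, smul_smul, ← map_mul, unitsConj_smul_eq_iff]
    have h' : (i = 0 ∧ j = 1) ∨ (i = 1 ∧ j = 0) := by
      rw [abs_eq (by norm_num)] at hij
      omega
    rcases h' with ⟨rfl, rfl⟩ | ⟨rfl, rfl⟩
    · rw [Units.val_mul, ← mul_assoc]
      exact mk_eq_of_rel (.tb8_one ⟨0, hin⟩ ⟨1, hjn⟩ rfl rfl)
    · rw [Units.val_mul, ← mul_assoc]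
      exact mk_eq_of_rel (.tb8_zero ⟨0, hjn⟩ ⟨1, hin⟩ rfl rfl)

theorem tiedAction_presented {n : ℕ} (hn : 2 ≤ n) : TiedAction n (conjGen n) (thetaNat n) where
  two_le := hn
  braid_zero := by
    rw [conjGen_of_lt (show 0 < n by omega), conjGen_of_lt (show 1 < n by omega)]
    simp only [← map_mul]
    exact congrArg _ (Units.ext (mk_eq_of_rel (.bb1 ⟨0, by omega⟩ ⟨1, by omega⟩ rfl rfl)))
  braid i hi hin := by
    rw [conjGen_of_lt (show i < n by omega), conjGen_of_lt hin]
    simp only [← map_mul]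
    exact congrArg _ (Units.ext (mk_eq_of_rel (.bb2 ⟨i, by omega⟩ ⟨i + 1, hin⟩ hi (by simp)
      (by simp))))
  comm i j hij hjn := by
    rw [conjGen_of_lt (show i < n by omega), conjGen_of_lt hjn]
    simp only [← map_mul]
    refine congrArg _ (Units.ext (mk_eq_of_rel (.bb3 ⟨i, by omega⟩ ⟨j, hjn⟩ ?_)))
    rw [le_abs]
    simp only
    omega
  fix i j hin hjn h1 h2 := by
    rw [conjGen_of_lt hin, thetaNat_of_lt hjn, unitsConj_smul_eq_iff]
    refine mk_eq_of_rel (.tb5 ⟨i, hin⟩ ⟨j, hjn⟩ ?_)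
    rw [Ne, abs_eq (by norm_num)]
    simp only
    omega
  fix_zero := by
    rw [conjGen_of_lt (show 0 < n by omega), conjGen_of_lt (show 1 < n by omega),
      thetaNat_of_lt (show 0 < n by omega), smul_smul, smul_smul, ← map_mul, ← map_mul,
      unitsConj_smul_eq_iff, Units.val_mul, Units.val_mul, ← mul_assoc, ← mul_assoc]
    exact (mk_eq_of_rel (.tb3_zero ⟨0, by omega⟩ ⟨1, by omega⟩ rfl rfl)).symm
  fix_one := by
    rw [conjGen_of_lt (show 0 < n by omega), conjGen_of_lt (show 1 < n by omega),
      thetaNat_of_lt (show 1 < n by omega), smul_smul, smul_smul, ← map_mul, ← map_mul,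
      unitsConj_smul_eq_iff, Units.val_mul, Units.val_mul, ← mul_assoc, ← mul_assoc]
    exact (mk_eq_of_rel (.tb3_one ⟨0, by omega⟩ ⟨1, by omega⟩ rfl rfl)).symm
  sq_fix i hin := conjGen_sq_smul (by omega) hin (by simp)
  sq_fix' i hin := conjGen_sq_smul hin (by omega) (by simp)
  adj i hi hin := by
    have h1 := (conjGen_smul_smul_adj (j := i + 1) hi (by omega) (by omega) hin (by simp)).1
    have h2 := conjGen_sq_smul (i := i) (j := i + 1) (by omega) hin (by simp)
    rw [← smul_left_cancel_iff (conjGen n i), h1, h2]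

/-! ### Relations between adjacent ties -/

theorem thetaNat_idem {n i : ℕ} : thetaNat n i * thetaNat n i = thetaNat n i := by
  by_cases h : i < n
  · rw [thetaNat_of_lt h]
    exact mk_eq_of_rel (.tb1 ⟨i, h⟩)
  · rw [thetaNat, dif_neg h, one_mul]

theorem thetaNat_comm {n : ℕ} (i j : ℕ) : Commute (thetaNat n i) (thetaNat n j) := by
  by_cases hi : i < n
  · by_cases hj : j < n
    · rw [thetaNat_of_lt hi, thetaNat_of_lt hj]
      exact mk_eq_of_rel (.tb2 ⟨i, hi⟩ ⟨j, hj⟩)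
    · rw [thetaNat.eq_1 n j, dif_neg hj]
      exact Commute.one_right _
  · rw [thetaNat, dif_neg hi]
    exact Commute.one_left _

/-- This is `tb6_left` with the trailing `σ_i` cancelled, so that it speaks of ties only. -/
theorem theta_mul_conj {n i j : ℕ} (hi : i < n) (hj : j < n) (hij : |(i : ℤ) - j| = 1) :
    thetaNat n j * (conjGen n i • thetaNat n j) = thetaNat n i * thetaNat n j := by
  rw [conjGen_of_lt hi, thetaNat_of_lt hi, thetaNat_of_lt hj, unitsConj_smul_def, ← mul_assoc,
    ← mul_assoc, Units.mul_inv_eq_iff_eq_mul]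
  exact (mk_eq_of_rel (.tb6_left ⟨i, hi⟩ ⟨j, hj⟩ hij)).symm

theorem conj_theta_mul_theta {n i j : ℕ} (hi : i < n) (hj : j < n) (hij : |(i : ℤ) - j| = 1) :
    conjGen n i • (thetaNat n i * thetaNat n j) = thetaNat n i * thetaNat n j := by
  rw [conjGen_of_lt hi, thetaNat_of_lt hi, thetaNat_of_lt hj, unitsConj_smul_eq_iff, ← mul_assoc]
  exact ((mk_eq_of_rel (.tb6_left ⟨i, hi⟩ ⟨j, hj⟩ hij)).trans
    (mk_eq_of_rel (.tb6_right ⟨i, hi⟩ ⟨j, hj⟩ hij))).symm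

theorem conj_mul_theta {n i j : ℕ} (hi : i < n) (hj : j < n) (hij : |(i : ℤ) - j| = 1) :
    (conjGen n i • thetaNat n j) * thetaNat n j = thetaNat n i * thetaNat n j := by
  have h := congrArg (fun x => conjGen n i • x) (theta_mul_conj hi hj hij)
  rwa [smul_mul', conjGen_sq_smul hi hj hij, conj_theta_mul_theta hi hj hij] at h

/-- Both products equal `θ_i * θ_j`. -/
theorem commute_theta_conj {n i j : ℕ} (hi : i < n) (hj : j < n) (hij : |(i : ℤ) - j| = 1) :
    Commute (thetaNat n j) (conjGen n i • thetaNat n j) :=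
  (theta_mul_conj hi hj hij).trans (conj_mul_theta hi hj hij).symm

/-! ### The ties of the presented monoid -/

/-- The conjugate of a generator `θ_i` attached to the pair `{a, b}`. -/
def tie {n : ℕ} (a b : PM n) : Presented n := tieAt (conjGen n) (thetaNat n) a b

theorem tie_comm {n : ℕ} (a b : PM n) : tie a b = tie b a := tieAt_comm a b

theorem tie_neg_neg {n : ℕ} (a b : PM n) : tie (-a) (-b) = tie a b := tieAt_neg_neg a b

theorem smul_tie {n : ℕ} (hn : 2 ≤ n) (g : BraidB n) (a b : PM n) :
    braidConj n g • tie a b = tie ((proj n g).1 a) ((proj n g).1 b) :=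
  (tiedAction_presented hn).braid_smul_tieAt (braidConj n) braidConj_braidGen g a b

theorem pos_natAbs {n : ℕ} (i : Fin n) : (pos i).1.natAbs = i + 1 := by
  rw [pos_val]
  omega

theorem tie_pos_pos {n k : ℕ} (hn : 2 ≤ n) (hk : k + 1 < n) :
    -- `pos` shifts by one: the points are `k + 1` and `k + 2`, whence the generator of index `k +
    -- 1`.
    tie (pos (⟨k, by omega⟩ : Fin n)) (pos ⟨k + 1, hk⟩) = thetaNat n (k + 1) := by
  have hs : ((pos (⟨k, by omega⟩ : Fin n)).sgn == (pos (⟨k + 1, hk⟩ : Fin n)).sgn) = true := by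
    rw [beq_iff_eq, PM.sgn_eq_iff, pos_val, pos_val]
    omega
  rw [tie, tieAt_of_lt (by rw [pos_natAbs, pos_natAbs]; simp), hs, pos_natAbs, pos_natAbs]
  exact (tiedAction_presented hn).pairTie_adj_eq (k := k + 1) (Nat.le_add_left _ _) hk

theorem tie_neg_pos_zero {n : ℕ} (hn : 0 < n) :
    tie (-pos (⟨0, hn⟩ : Fin n)) (pos ⟨0, hn⟩) = thetaNat n 0 := by
  rw [tie, tieAt, if_pos (by rw [PM.val_neg, Int.natAbs_neg]), PM.val_neg, Int.natAbs_neg,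
    pos_natAbs]
  rfl

theorem tie_pos_one_neg {n : ℕ} (hn : 1 < n) :
    tie (-pos (⟨1, hn⟩ : Fin n)) (pos ⟨1, hn⟩) = conjGen n 1 • thetaNat n 0 := by
  rw [tie, tieAt, if_pos (by rw [PM.val_neg, Int.natAbs_neg]), PM.val_neg, Int.natAbs_neg,
    pos_natAbs]
  rfl

theorem tie_neg_zero_one {n : ℕ} (hn : 1 < n) :
    tie (-pos (⟨0, by omega⟩ : Fin n)) (pos ⟨1, hn⟩) = conjGen n 0 • thetaNat n 1 := by
  have hs : ((-pos (⟨0, by omega⟩ : Fin n)).sgn == (pos (⟨1, hn⟩ : Fin n)).sgn) = false := by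
    rw [beq_eq_false_iff_ne, Ne, PM.sgn_eq_iff, PM.val_neg, pos_val, pos_val]
    simp
  rw [tie, tieAt_of_lt (by rw [PM.val_neg, Int.natAbs_neg, pos_natAbs, pos_natAbs]; simp), hs,
    PM.val_neg, Int.natAbs_neg, pos_natAbs, pos_natAbs]
  rfl

theorem tie_zero_two {n : ℕ} (hn : 2 < n) :
    tie (pos (⟨0, by omega⟩ : Fin n)) (pos ⟨2, hn⟩) = conjGen n 2 • thetaNat n 1 := by
  have hs : ((pos (⟨0, by omega⟩ : Fin n)).sgn == (pos (⟨2, hn⟩ : Fin n)).sgn) = true := by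
    rw [beq_iff_eq, PM.sgn_eq_iff, pos_val, pos_val]
    simp
  rw [tie, tieAt_of_lt (by rw [pos_natAbs, pos_natAbs]; simp), hs, pos_natAbs, pos_natAbs]
  rfl

/-! ### Commutation and absorption of ties -/

theorem exists_braid_two {n : ℕ} (hn : 2 ≤ n) {a b : PM n} (h : a.1.natAbs ≠ b.1.natAbs) :
    ∃ g : BraidB n, (proj n g).1 (pos ⟨0, by omega⟩) = a ∧
      (proj n g).1 (pos ⟨1, hn⟩) = b := by
  obtain ⟨g, hg⟩ := exists_braid_tuple 2 hn ![a, b] (by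
    intro i j hij
    fin_cases i <;> fin_cases j <;> simp_all [eq_comm])
  exact ⟨g, hg 0 _ rfl, hg 1 _ rfl⟩

theorem exists_braid_three {n : ℕ} {a b c : PM n} (h1 : a.1.natAbs ≠ b.1.natAbs)
    (h2 : a.1.natAbs ≠ c.1.natAbs) (h3 : b.1.natAbs ≠ c.1.natAbs) :
    ∃ (hn : 2 < n) (g : BraidB n), (proj n g).1 (pos ⟨0, by omega⟩) = a ∧
      (proj n g).1 (pos ⟨1, by omega⟩) = b ∧ (proj n g).1 (pos ⟨2, hn⟩) = c := by
  have ha := a.natAbs_pos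
  have hb := b.natAbs_pos
  have hc := c.natAbs_pos
  have ha' := a.natAbs_le
  have hb' := b.natAbs_le
  have hc' := c.natAbs_le
  have hn : 2 < n := by omega
  obtain ⟨g, hg⟩ := exists_braid_tuple 3 hn ![a, b, c] (by
    intro i j hij
    fin_cases i <;> fin_cases j <;> simp_all [eq_comm])
  exact ⟨hn, g, hg 0 _ rfl, hg 1 _ rfl, hg 2 _ rfl⟩

theorem exists_braid_four {n : ℕ} {a b c d : PM n} (h1 : a.1.natAbs ≠ b.1.natAbs)
    (h2 : a.1.natAbs ≠ c.1.natAbs) (h3 : b.1.natAbs ≠ c.1.natAbs)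
    (h4 : a.1.natAbs ≠ d.1.natAbs) (h5 : b.1.natAbs ≠ d.1.natAbs)
    (h6 : c.1.natAbs ≠ d.1.natAbs) :
    ∃ (hn : 3 < n) (g : BraidB n), (proj n g).1 (pos ⟨0, by omega⟩) = a ∧
      (proj n g).1 (pos ⟨1, by omega⟩) = b ∧ (proj n g).1 (pos ⟨2, by omega⟩) = c ∧
      (proj n g).1 (pos ⟨3, hn⟩) = d := by
  have ha := a.natAbs_pos
  have hb := b.natAbs_pos
  have hc := c.natAbs_pos
  have hd := d.natAbs_pos
  have ha' := a.natAbs_le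
  have hb' := b.natAbs_le
  have hc' := c.natAbs_le
  have hd' := d.natAbs_le
  have hn : 3 < n := by omega
  obtain ⟨g, hg⟩ := exists_braid_tuple 4 hn ![a, b, c, d] (by
    intro i j hij
    fin_cases i <;> fin_cases j <;> simp_all [eq_comm])
  exact ⟨hn, g, hg 0 _ rfl, hg 1 _ rfl, hg 2 _ rfl, hg 3 _ rfl⟩

/-- Conjugation is an automorphism, so each configuration of two pairs needs treatment in one
standard position only. -/
theorem commute_tie_map {n : ℕ} (hn : 2 ≤ n) (g : BraidB n) {a b c d : PM n}
    (h : Commute (tie a b) (tie c d)) :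
    Commute (tie ((proj n g).1 a) ((proj n g).1 b)) (tie ((proj n g).1 c) ((proj n g).1 d)) := by
  rw [← smul_tie hn, ← smul_tie hn]
  exact h.map (braidConj n g).toMonoidHom

theorem commute_tie_neg_neg {n : ℕ} (hn : 2 ≤ n) {a b : PM n} (h : a.1.natAbs ≠ b.1.natAbs) :
    Commute (tie (-a) a) (tie (-b) b) := by
  obtain ⟨g, rfl, rfl⟩ := exists_braid_two hn h
  rw [← SignedPerm.map_neg, ← SignedPerm.map_neg]
  refine commute_tie_map hn g ?_
  rw [tie_neg_pos_zero, tie_pos_one_neg]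
  exact commute_theta_conj (by omega) (by omega) (by simp)

theorem commute_tie_neg_left {n : ℕ} (hn : 2 ≤ n) {a b : PM n} (h : a.1.natAbs ≠ b.1.natAbs) :
    Commute (tie (-a) a) (tie a b) := by
  obtain ⟨g, rfl, rfl⟩ := exists_braid_two hn h
  rw [← SignedPerm.map_neg]
  refine commute_tie_map hn g ?_
  rw [tie_neg_pos_zero, tie_pos_pos hn hn]
  exact thetaNat_comm _ _

theorem commute_tie_neg_of_ne {n : ℕ} (hn : 2 ≤ n) {a b c : PM n} (h1 : a.1.natAbs ≠ b.1.natAbs)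
    (h2 : a.1.natAbs ≠ c.1.natAbs) (h3 : b.1.natAbs ≠ c.1.natAbs) :
    Commute (tie (-a) a) (tie b c) := by
  obtain ⟨hn', g, rfl, rfl, rfl⟩ := exists_braid_three h1 h2 h3
  rw [← SignedPerm.map_neg]
  refine commute_tie_map hn g ?_
  rw [tie_neg_pos_zero, tie_pos_pos hn hn']
  exact thetaNat_comm _ _

theorem commute_tie_signs {n : ℕ} (hn : 2 ≤ n) {a b : PM n} (h : a.1.natAbs ≠ b.1.natAbs) :
    Commute (tie a b) (tie (-a) b) := by
  obtain ⟨g, rfl, rfl⟩ := exists_braid_two hn h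
  rw [← SignedPerm.map_neg]
  refine commute_tie_map hn g ?_
  rw [tie_pos_pos hn hn, tie_neg_zero_one]
  exact commute_theta_conj (by omega) (by omega) (by simp)

theorem commute_tie_adj {n : ℕ} (hn : 2 ≤ n) {a b c : PM n} (h1 : a.1.natAbs ≠ b.1.natAbs)
    (h2 : a.1.natAbs ≠ c.1.natAbs) (h3 : b.1.natAbs ≠ c.1.natAbs) :
    Commute (tie a b) (tie b c) := by
  obtain ⟨hn', g, rfl, rfl, rfl⟩ := exists_braid_three h1 h2 h3
  refine commute_tie_map hn g ?_
  rw [tie_pos_pos hn hn, tie_pos_pos hn hn']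
  exact thetaNat_comm _ _

theorem commute_tie_disjoint {n : ℕ} (hn : 2 ≤ n) {a b c d : PM n}
    (h1 : a.1.natAbs ≠ b.1.natAbs)
    (h2 : a.1.natAbs ≠ c.1.natAbs) (h3 : b.1.natAbs ≠ c.1.natAbs)
    (h4 : a.1.natAbs ≠ d.1.natAbs) (h5 : b.1.natAbs ≠ d.1.natAbs)
    (h6 : c.1.natAbs ≠ d.1.natAbs) : Commute (tie a b) (tie c d) := by
  obtain ⟨hn', g, rfl, rfl, rfl, rfl⟩ := exists_braid_four h1 h2 h3 h4 h5 h6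
  refine commute_tie_map hn g ?_
  rw [tie_pos_pos hn hn, tie_pos_pos hn hn']
  exact thetaNat_comm _ _

theorem commute_tie_neg_of_natAbs_eq {n : ℕ} (hn : 2 ≤ n) {a c d : PM n}
    (h1 : a.1.natAbs = c.1.natAbs) (h2 : c.1.natAbs ≠ d.1.natAbs) :
    Commute (tie (-a) a) (tie c d) := by
  rcases PM.natAbs_eq_natAbs_iff.1 h1 with rfl | rfl
  · exact commute_tie_neg_left hn h2
  · rw [tie_neg_neg]
    exact commute_tie_neg_left hn h2

theorem commute_tie_neg {n : ℕ} (hn : 2 ≤ n) (a : PM n) {c d : PM n} (hcd : c ≠ d) :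
    Commute (tie (-a) a) (tie c d) := by
  by_cases h : c.1.natAbs = d.1.natAbs
  · obtain rfl := (PM.natAbs_eq_natAbs_iff.1 h).resolve_left hcd
    by_cases hd : a.1.natAbs = d.1.natAbs
    · rcases PM.natAbs_eq_natAbs_iff.1 hd with rfl | rfl
      · exact Commute.refl _
      · rw [tie_neg_neg]
    · exact commute_tie_neg_neg hn hd
  · by_cases hc : a.1.natAbs = c.1.natAbs
    · exact commute_tie_neg_of_natAbs_eq hn hc h
    · by_cases hd : a.1.natAbs = d.1.natAbs
      · rw [tie_comm c]
        exact commute_tie_neg_of_natAbs_eq hn hd (Ne.symm h)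
      · exact commute_tie_neg_of_ne hn hc hd h

theorem commute_tie_shared {n : ℕ} (hn : 2 ≤ n) {a b c d : PM n}
    (hab : a.1.natAbs ≠ b.1.natAbs) (hbc : b.1.natAbs = c.1.natAbs)
    (hcd : c.1.natAbs ≠ d.1.natAbs) : Commute (tie a b) (tie c d) := by
  have key : ∀ d : PM n, b.1.natAbs ≠ d.1.natAbs → Commute (tie a b) (tie b d) := by
    intro d hd
    by_cases had : a.1.natAbs = d.1.natAbs
    · rcases PM.natAbs_eq_natAbs_iff.1 had with rfl | rfl
      · rw [tie_comm]
      · rw [tie_comm b]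
        have := commute_tie_signs hn hab
        rwa [PM.neg_neg] at this
    · exact commute_tie_adj hn hab had hd
  rcases PM.natAbs_eq_natAbs_iff.1 hbc with rfl | rfl
  · exact key d hcd
  · rw [← tie_neg_neg c]
    exact key (-d) (by rwa [PM.val_neg, PM.val_neg, Int.natAbs_neg, Int.natAbs_neg])

theorem commute_tie {n : ℕ} (hn : 2 ≤ n) {a b c d : PM n} (hab : a ≠ b) (hcd : c ≠ d) :
    Commute (tie a b) (tie c d) := by
  by_cases h1 : a.1.natAbs = b.1.natAbs
  · obtain rfl := (PM.natAbs_eq_natAbs_iff.1 h1).resolve_left hab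
    exact commute_tie_neg hn b hcd
  by_cases h2 : c.1.natAbs = d.1.natAbs
  · obtain rfl := (PM.natAbs_eq_natAbs_iff.1 h2).resolve_left hcd
    exact (commute_tie_neg hn d hab).symm
  by_cases h3 : b.1.natAbs = c.1.natAbs
  · exact commute_tie_shared hn h1 h3 h2
  by_cases h4 : a.1.natAbs = c.1.natAbs
  · rw [tie_comm a]
    exact commute_tie_shared hn (Ne.symm h1) h4 h2
  by_cases h5 : b.1.natAbs = d.1.natAbs
  · rw [tie_comm c]
    exact commute_tie_shared hn h1 h5 (Ne.symm h2)
  by_cases h6 : a.1.natAbs = d.1.natAbs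
  · rw [tie_comm a, tie_comm c]
    exact commute_tie_shared hn (Ne.symm h1) h6 (Ne.symm h2)
  exact commute_tie_disjoint hn h1 h4 h3 h6 h5 h2

theorem tie_idem {n : ℕ} (hn : 2 ≤ n) {a b : PM n} (hab : a ≠ b) :
    tie a b * tie a b = tie a b := by
  by_cases h : a.1.natAbs = b.1.natAbs
  · obtain rfl := (PM.natAbs_eq_natAbs_iff.1 h).resolve_left hab
    -- A second absolute value exists because `n ≥ 2`; it serves only to apply `exists_braid_two`.
    obtain ⟨c, hc⟩ : ∃ c : PM n, b.1.natAbs ≠ c.1.natAbs := by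
      by_cases hb : b.1.natAbs = 1
      · exact ⟨pos ⟨1, hn⟩, by rw [pos_natAbs]; simp [hb]⟩
      · exact ⟨pos ⟨0, by omega⟩, by rw [pos_natAbs]; simpa using hb⟩
    obtain ⟨g, rfl, -⟩ := exists_braid_two hn hc
    rw [← SignedPerm.map_neg, ← smul_tie hn, ← smul_mul', tie_neg_pos_zero, thetaNat_idem]
  · obtain ⟨g, rfl, rfl⟩ := exists_braid_two hn h
    rw [← smul_tie hn, ← smul_mul', tie_pos_pos hn hn, thetaNat_idem]

/-- Two distinct ties on `{±a, ±b}` already put these four points into one zero block, so all the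
products should agree. In standard position they are instances of the relations between `θ_0`, `θ_1`
and their conjugates. -/
theorem tie_rank_two {n : ℕ} (hn : 2 ≤ n) {a b : PM n} (h : a.1.natAbs ≠ b.1.natAbs) :
    tie a b * tie (-a) b = tie (-a) a * tie a b ∧
    tie (-a) a * tie (-a) b = tie (-a) a * tie a b ∧
    tie (-a) a * tie (-b) b = tie (-a) a * tie a b := by
  obtain ⟨g, rfl, rfl⟩ := exists_braid_two hn h
  simp only [← SignedPerm.map_neg, ← smul_tie hn, ← smul_mul', smul_left_cancel_iff]
  rw [tie_neg_pos_zero, tie_pos_pos hn hn, tie_neg_zero_one, tie_pos_one_neg]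
  refine ⟨theta_mul_conj (by omega) hn (by simp), ?_, ?_⟩
  · have h1 := conj_theta_mul_theta (i := 0) (j := 1) (by omega) hn (by simp)
    rwa [smul_mul', (tiedAction_presented hn).fix 0 0 (by omega) (by omega) (by omega)
      (by omega)] at h1
  · rw [theta_mul_conj hn (by omega) (by simp), (thetaNat_comm _ _).eq]

theorem tie_mul_tie_neg_neg_mul {n : ℕ} (hn : 2 ≤ n) {a b : PM n}
    (h : a.1.natAbs ≠ b.1.natAbs) :
    tie (-a) a * tie (-b) b * tie a b = tie (-a) a * tie (-b) b := by
  have hab : a ≠ b := fun hab => h (hab ▸ rfl)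
  rw [(tie_rank_two hn h).2.2, mul_assoc, tie_idem hn hab]

/-- If two of the points are opposite, only two absolute values occur and `tie_rank_two` applies.
Otherwise the points can be taken to be `1, 2, 3`, where the third tie is the conjugate of `θ_1` by
`σ_2`. -/
theorem tie_mul_tie_mul_tie {n : ℕ} (hn : 2 ≤ n) {a b c : PM n} (hab : a ≠ b) (hbc : b ≠ c)
    (hac : a ≠ c) : tie a b * tie b c * tie a c = tie a b * tie b c := by
  by_cases h1 : a.1.natAbs = b.1.natAbs
  · obtain rfl := (PM.natAbs_eq_natAbs_iff.1 h1).resolve_left hab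
    have h2 : b.1.natAbs ≠ c.1.natAbs := fun h =>
      (PM.natAbs_eq_natAbs_iff.1 h).elim hbc fun h => hac (by rw [h, PM.neg_neg])
    obtain ⟨h3, h4, -⟩ := tie_rank_two hn h2
    rw [mul_assoc, h3, ← mul_assoc, tie_idem hn hab]
  by_cases h2 : b.1.natAbs = c.1.natAbs
  · obtain rfl := (PM.natAbs_eq_natAbs_iff.1 h2).resolve_left hbc
    obtain ⟨h3, h4, -⟩ := tie_rank_two hn (a := c) (b := a)
      (by rw [PM.val_neg, Int.natAbs_neg] at h1; exact Ne.symm h1)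
    rw [tie_comm a, tie_comm a c, (commute_tie hn (Ne.symm hab) hbc).eq, h4, mul_assoc,
      tie_idem hn (Ne.symm hac)]
  by_cases h3 : a.1.natAbs = c.1.natAbs
  · obtain rfl := (PM.natAbs_eq_natAbs_iff.1 h3).resolve_left hac
    obtain ⟨h4, h5, -⟩ := tie_rank_two hn (a := c) (b := b) (Ne.symm h2)
    rw [tie_comm b, (commute_tie hn hab (Ne.symm hbc)).eq, h4,
      (commute_tie hn hac (Ne.symm hbc)).eq, mul_assoc, tie_idem hn hac]
  · obtain ⟨hn', g, rfl, rfl, rfl⟩ := exists_braid_three h1 h3 h2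
    simp only [← smul_tie hn, ← smul_mul', smul_left_cancel_iff]
    rw [tie_pos_pos hn hn, tie_pos_pos hn hn', tie_zero_two hn', (thetaNat_comm _ _).eq, mul_assoc,
      theta_mul_conj hn' hn (by simp), ← mul_assoc, thetaNat_idem]

/-! ### The embedding of the monoid of partitions -/

instance (n : ℕ) : Finite (PM n) :=
  Set.Finite.to_subtype ((Set.finite_Icc (-(n : ℤ)) n).subset fun _ hk => abs_le.1 hk.2)

/-- The partition of type `B` that joins `a` and `b` if the tie of `{a, b}` is absorbed
by `S`. -/
def absorbed {n : ℕ} (hn : 2 ≤ n) (S : Presented n) : PB n where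
  part :=
    -- Equality is a separate clause because `tie a a` is the tie of `{-a, a}`, which `S` need not
    -- absorb.
    { r := fun a b => a = b ∨ S * tie a b = S
      iseqv := by
        refine ⟨fun x => Or.inl rfl, ?_, ?_⟩
        · rintro x y (h | h)
          · exact Or.inl h.symm
          · exact Or.inr (by rwa [tie_comm])
        · intro x y z hxy hyz
          by_cases h1 : x = y
          · rwa [h1]
          by_cases h2 : y = z
          · rwa [← h2]
          by_cases h3 : x = z
          · exact Or.inl h3
          have h4 := hxy.resolve_left h1
          have h5 := hyz.resolve_left h2
          refine Or.inr ?_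
          have h6 := congrArg (S * ·) (tie_mul_tie_mul_tie hn h1 h2 h3)
          simpa only [← mul_assoc, h4, h5] using h6 }
  isB := by
    rw [isBPartition_iff, isSigned_iff]
    refine ⟨?_, ?_⟩
    · rintro x y (rfl | h)
      · exact Or.inl rfl
      · exact Or.inr (by rwa [tie_neg_neg])
    · intro x y hx hy
      have hne : ∀ z : PM n, z ≠ -z := fun z hz => by
        have h1 := congrArg Subtype.val hz
        have h2 := z.2.1
        rw [PM.val_neg] at h1
        omega
      have hx' := hx.resolve_left (hne x)
      have hy' := hy.resolve_left (hne y)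
      by_cases h : x.1.natAbs = y.1.natAbs
      · rcases PM.natAbs_eq_natAbs_iff.1 h with rfl | rfl
        · exact Or.inl rfl
        · exact Or.inr (by rwa [tie_comm])
      · rw [tie_comm] at hx' hy'
        -- Absorbing the ties of `{-x, x}` and `{-y, y}` forces absorbing that of `{x, y}`: at most
        -- one zero block.
        have h6 := congrArg (S * ·) (tie_mul_tie_neg_neg_mul hn h)
        exact Or.inr (by simpa only [← mul_assoc, hx', hy'] using h6)

/-! ### Products of ties over the related pairs of a partition -/

theorem list_prod_mul_of_mem {M : Type*} [Monoid M] {l : List M} (h : ∀ x ∈ l, ∀ y ∈ l, Commute x y)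
    {x : M} (hx : x ∈ l) (hi : x * x = x) : l.prod * x = l.prod := by
  induction l with
  | nil => simp at hx
  | cons y l ih =>
    rw [List.prod_cons]
    rcases List.mem_cons.1 hx with rfl | hx'
    · rw [mul_assoc, ← (Commute.list_prod_right _ _ fun z hz =>
        h x (by simp) z (List.mem_cons_of_mem _ hz)).eq, ← mul_assoc, hi]
    · rw [mul_assoc, ih (fun a ha b hb => h a (List.mem_cons_of_mem _ ha) b
        (List.mem_cons_of_mem _ hb)) hx']

open Classical in
/-- The pairs of distinct elements in the same block. -/
noncomputable def relatedPairs {n : ℕ} (I : PB n) : List (PM n × PM n) :=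
  (Set.toFinite {p : PM n × PM n | p.1 ≠ p.2 ∧ I.part p.1 p.2}).toFinset.toList

theorem mem_relatedPairs {n : ℕ} {I : PB n} {p : PM n × PM n} :
    p ∈ relatedPairs I ↔ p.1 ≠ p.2 ∧ I.part p.1 p.2 := by
  simp [relatedPairs]

/-- The product of the ties of all pairs of related elements. -/
noncomputable def tieProd {n : ℕ} (I : PB n) : Presented n :=
  ((relatedPairs I).map fun p => tie p.1 p.2).prod

theorem tieProd_mul_tie {n : ℕ} (hn : 2 ≤ n) (I : PB n) {a b : PM n} (hab : a ≠ b)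
    (h : I.part a b) : tieProd I * tie a b = tieProd I := by
  refine list_prod_mul_of_mem ?_ (List.mem_map.2 ⟨(a, b), mem_relatedPairs.2 ⟨hab, h⟩, rfl⟩)
    (tie_idem hn hab)
  intro x hx y hy
  obtain ⟨p, hp, rfl⟩ := List.mem_map.1 hx
  obtain ⟨q, hq, rfl⟩ := List.mem_map.1 hy
  exact commute_tie hn (mem_relatedPairs.1 hp).1 (mem_relatedPairs.1 hq).1

theorem mul_list_prod_eq_self {M : Type*} [Monoid M] {l : List M} {S : M}
    (h : ∀ x ∈ l, S * x = S) : S * l.prod = S := by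
  induction l with
  | nil => simp
  | cons y l ih =>
    rw [List.prod_cons, ← mul_assoc, h y (by simp),
      ih fun x hx => h x (List.mem_cons_of_mem _ hx)]

theorem mul_tieProd {n : ℕ} {S : Presented n} {I : PB n}
    (h : ∀ a b, a ≠ b → I.part a b → S * tie a b = S) : S * tieProd I = S := by
  refine mul_list_prod_eq_self fun x hx => ?_
  obtain ⟨p, hp, rfl⟩ := List.mem_map.1 hx
  exact h _ _ (mem_relatedPairs.1 hp).1 (mem_relatedPairs.1 hp).2

/-- Together with `le_absorbed_of_mul` this turns absorption of `tieProd I` by `S` into an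
inequality of partitions, to which the universal property of the product in `PB n` applies. -/
theorem mul_tieProd_of_le {n : ℕ} (hn : 2 ≤ n) {S : Presented n} {I : PB n}
    (h : I.part ≤ (absorbed hn S).part) : S * tieProd I = S :=
  mul_tieProd fun _ _ hab hI => (h hI).resolve_left hab

theorem le_absorbed_of_mul {n : ℕ} (hn : 2 ≤ n) {S : Presented n} {I : PB n}
    (h : S * tieProd I = S) : I.part ≤ (absorbed hn S).part := by
  intro a b hab
  by_cases hne : a = b
  · exact Or.inl hne
  · refine Or.inr ?_
    rw [← h, mul_assoc, tieProd_mul_tie hn I hne hab]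

theorem commute_tie_tieProd {n : ℕ} (hn : 2 ≤ n) (I : PB n) {a b : PM n} (hab : a ≠ b) :
    Commute (tie a b) (tieProd I) := by
  refine Commute.list_prod_right _ _ fun x hx => ?_
  obtain ⟨p, hp, rfl⟩ := List.mem_map.1 hx
  exact commute_tie hn hab (mem_relatedPairs.1 hp).1

theorem commute_tieProd {n : ℕ} (hn : 2 ≤ n) (I J : PB n) :
    Commute (tieProd I) (tieProd J) := by
  refine Commute.list_prod_left _ _ fun x hx => ?_
  obtain ⟨p, hp, rfl⟩ := List.mem_map.1 hx
  exact commute_tie_tieProd hn J (mem_relatedPairs.1 hp).1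

theorem tieProd_idem {n : ℕ} (hn : 2 ≤ n) (I : PB n) : tieProd I * tieProd I = tieProd I :=
  mul_tieProd fun _ _ hab hI => tieProd_mul_tie hn I hab hI

theorem tieProd_mul_of_le {n : ℕ} (hn : 2 ≤ n) {I J : PB n} (h : J.part ≤ I.part) :
    tieProd I * tieProd J = tieProd I :=
  mul_tieProd fun _ _ hab hJ => tieProd_mul_tie hn I hab (h hJ)

/-- Each side absorbs the other and they commute, so they are equal. For `h2`, the partition
`absorbed` by the right side is of type `B` and lies above `I` and `J`, hence above `I * J`. -/
theorem tieProd_mul {n : ℕ} (hn : 2 ≤ n) (I J : PB n) :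
    tieProd (I * J) = tieProd I * tieProd J := by
  obtain ⟨hI, hJ⟩ := (PB.mul_part_le_iff I J (I * J)).1 le_rfl
  have h1 : tieProd (I * J) * (tieProd I * tieProd J) = tieProd (I * J) := by
    rw [← mul_assoc, tieProd_mul_of_le hn hI, tieProd_mul_of_le hn hJ]
  have h2 : tieProd I * tieProd J * tieProd (I * J) = tieProd I * tieProd J := by
    refine mul_tieProd_of_le hn ((PB.mul_part_le_iff _ _ _).2 ⟨?_, ?_⟩) <;>
      refine le_absorbed_of_mul hn ?_
    · rw [mul_assoc, (commute_tieProd hn J I).eq, ← mul_assoc, tieProd_idem hn]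
    · rw [mul_assoc, tieProd_idem hn]
  rw [← h1, ← ((commute_tieProd hn I _).mul_left (commute_tieProd hn J _)).eq, h2]

theorem tieProd_one {n : ℕ} : tieProd (1 : PB n) = 1 := by
  have h := mul_tieProd (S := (1 : Presented n)) (I := 1) fun a b hab h => absurd h hab
  rwa [one_mul] at h

theorem rho_apply_part {n : ℕ} (g : BraidB n) (I : PB n) (a b : PM n) :
    (rho n g I).part ((proj n g).1 a) ((proj n g).1 b) ↔ I.part a b := by
  have h : ∀ x, (proj n g).1⁻¹ ((proj n g).1 x) = x := (proj n g).1.symm_apply_apply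
  change I.part ((proj n g).1⁻¹ _) ((proj n g).1⁻¹ _) ↔ _
  rw [h, h]

theorem exists_proj_apply {n : ℕ} (g : BraidB n) (a : PM n) : ∃ x, (proj n g).1 x = a :=
  (proj n g).1.surjective a

/-- Both sides are products of the same ties, but possibly listed in different orders; mutual
absorption and commutation avoid matching the lists. -/
theorem smul_tieProd {n : ℕ} (hn : 2 ≤ n) (g : BraidB n) (I : PB n) :
    braidConj n g • tieProd I = tieProd (rho n g I) := by
  have h1 : (braidConj n g • tieProd I) * tieProd (rho n g I) = braidConj n g • tieProd I := by
    refine mul_tieProd fun a b hab h => ?_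
    obtain ⟨x, rfl⟩ := exists_proj_apply g a
    obtain ⟨y, rfl⟩ := exists_proj_apply g b
    rw [← smul_tie hn, ← smul_mul', tieProd_mul_tie hn I (fun h => hab (congrArg _ h))
      ((rho_apply_part g I x y).1 h)]
  have h2 : tieProd (rho n g I) * (braidConj n g • tieProd I) = tieProd (rho n g I) := by
    -- The absorption is pulled back by `g`, so that the absorbed factor becomes `tieProd I` itself.
    have h3 : (braidConj n g)⁻¹ • tieProd (rho n g I) * tieProd I =
        (braidConj n g)⁻¹ • tieProd (rho n g I) := by
      refine mul_tieProd fun a b hab h => ?_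
      rw [← smul_left_cancel_iff (braidConj n g), smul_mul', smul_inv_smul, smul_tie hn]
      exact tieProd_mul_tie hn _ (fun h' => hab ((proj n g).1.injective h'))
        ((rho_apply_part g I a b).2 h)
    rw [← smul_left_cancel_iff (braidConj n g), smul_mul', smul_inv_smul] at h3
    exact h3
  have h3 : Commute (braidConj n g • tieProd I) (tieProd (rho n g I)) := by
    have h4 : braidConj n g • tieProd I =
        ((relatedPairs I).map fun p => tie ((proj n g).1 p.1) ((proj n g).1 p.2)).prod := by
      rw [tieProd, MulAut.smul_def, map_list_prod, List.map_map]
      exact congrArg _ (List.map_congr_left fun p _ => smul_tie hn g p.1 p.2)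
    rw [h4]
    refine Commute.list_prod_left _ _ fun x hx => ?_
    obtain ⟨p, hp, rfl⟩ := List.mem_map.1 hx
    exact commute_tie_tieProd hn _ fun h =>
      (mem_relatedPairs.1 hp).1 ((proj n g).1.injective h)
  rw [← h1, h3.eq, h2]

/-! ### The partitions `eps a b` as generators of `PB n` -/

/-- This universal property, used with `PB.eq_of_le_iff`, reduces identities between products of
`eps` to statements about an arbitrary partition of type `B`. -/
theorem eps_le_iff {n : ℕ} (a b : PM n) (K : PB n) :
    (eps a b).part ≤ K.part ↔ K.part a b := by
  have hK := (isSigned_iff _).1 K.isB.1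
  constructor
  · intro h
    refine h (le_zeroClosure _ ((le_sup_right : mu {a, b} ≤ _) (Or.inr ⟨?_, ?_⟩))) <;> simp
  · intro h
    have key : mu {a, b} ≤ K.part := by
      rintro x y (rfl | ⟨rfl | rfl, rfl | rfl⟩)
      exacts [K.part.refl _, K.part.refl _, h, K.part.symm h, K.part.refl _]
    refine zeroClosure_le (isSigned_mu_sup _) K.isB (sup_le ?_ key)
    rintro x y (rfl | ⟨hx, hy⟩)
    · exact K.part.refl _
    · have h1 := hK _ _ (key (Or.inr ⟨hx, hy⟩))
      rwa [PM.neg_neg, PM.neg_neg] at h1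

theorem tieProd_eps {n : ℕ} (hn : 2 ≤ n) {a b : PM n} (hab : a ≠ b) :
    tieProd (eps a b) = tie a b := by
  have h1 : tieProd (eps a b) * tie a b = tieProd (eps a b) :=
    tieProd_mul_tie hn _ hab ((eps_le_iff a b _).1 le_rfl)
  have h2 : tie a b * tieProd (eps a b) = tie a b :=
    mul_tieProd_of_le hn ((eps_le_iff a b _).2 (Or.inr (tie_idem hn hab)))
  rw [← h1, ← (commute_tie_tieProd hn _ hab).eq, h2]

theorem PB.prod_le_iff {n : ℕ} (l : List (PB n)) (K : PB n) :
    l.prod.part ≤ K.part ↔ ∀ I ∈ l, I.part ≤ K.part := by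
  induction l with
  | nil => simp [PB.one_part]
  | cons I l ih => rw [List.prod_cons, PB.mul_part_le_iff, ih, List.forall_mem_cons]

/-- The list is the one in `tieProd`, so `toTied` can later be compared factor by factor. -/
theorem prod_eps {n : ℕ} (I : PB n) :
    ((relatedPairs I).map fun p => eps p.1 p.2).prod = I := by
  refine PB.eq_of_le_iff fun K => ?_
  rw [PB.prod_le_iff]
  constructor
  · intro h a b hab
    by_cases hne : a = b
    · exact hne ▸ K.part.refl _
    · exact (eps_le_iff a b K).1
        (h _ (List.mem_map.2 ⟨(a, b), mem_relatedPairs.2 ⟨hne, hab⟩, rfl⟩))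
  · intro h J hJ
    obtain ⟨p, hp, rfl⟩ := List.mem_map.1 hJ
    exact (eps_le_iff _ _ K).2 (h (mem_relatedPairs.1 hp).2)

/-! ### The action of the braid group on partitions joining two points -/

theorem eps_comm {n : ℕ} (a b : PM n) : eps a b = eps b a :=
  PB.eq_of_le_iff fun K => by
    rw [eps_le_iff, eps_le_iff]
    exact ⟨K.part.symm, K.part.symm⟩

theorem PB.rel_neg_neg {n : ℕ} (K : PB n) {a b : PM n} : K.part (-a) (-b) ↔ K.part a b := by
  have h := (isSigned_iff _).1 K.isB.1
  exact ⟨fun hab => by have := h _ _ hab; rwa [PM.neg_neg, PM.neg_neg] at this, h a b⟩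

theorem eps_neg_neg {n : ℕ} (a b : PM n) : eps (-a) (-b) = eps a b :=
  PB.eq_of_le_iff fun K => by rw [eps_le_iff, eps_le_iff, K.rel_neg_neg]

theorem eps_eq_eps {n : ℕ} {a b c d : PM n}
    (h : (a.1 = c.1 ∧ b.1 = d.1) ∨ (a.1 = d.1 ∧ b.1 = c.1) ∨ (a.1 = -c.1 ∧ b.1 = -d.1) ∨
      (a.1 = -d.1 ∧ b.1 = -c.1)) : eps a b = eps c d := by
  rcases h with ⟨h1, h2⟩ | ⟨h1, h2⟩ | ⟨h1, h2⟩ | ⟨h1, h2⟩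
  · rw [PM.ext h1, PM.ext h2]
  · rw [PM.ext h1, PM.ext h2, eps_comm]
  · rw [PM.ext (y := -c) h1, PM.ext (y := -d) h2, eps_neg_neg]
  · rw [PM.ext (y := -d) h1, PM.ext (y := -c) h2, eps_neg_neg, eps_comm]

theorem PB.mul_self {n : ℕ} (I : PB n) : I * I = I :=
  PB.eq_of_le_iff fun K => by rw [PB.mul_part_le_iff, and_self]

theorem eps_mul_eps {n : ℕ} (a b c : PM n) : eps a b * eps b c = eps a b * eps a c :=
  PB.eq_of_le_iff fun K => by
    simp only [PB.mul_part_le_iff, eps_le_iff]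
    exact and_congr_right fun h => ⟨K.part.trans h, K.part.trans (K.part.symm h)⟩

/-- The join alone would leave two zero blocks; the identity rests on their being merged. -/
theorem eps_neg_mul_eps_neg {n : ℕ} (a b : PM n) :
    eps (-a) a * eps (-b) b = eps (-a) a * eps a b :=
  PB.eq_of_le_iff fun K => by
    simp only [PB.mul_part_le_iff, eps_le_iff]
    refine and_congr_right fun h => ⟨fun h' => ?_, fun h' => ?_⟩
    · exact ((isBPartition_iff _).1 K.isB).2 a b (K.part.symm h) (K.part.symm h')
    · exact K.part.trans (K.rel_neg_neg.2 (K.part.symm h')) (K.part.trans h h')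

theorem rho_eps {n : ℕ} (g : BraidB n) (a b : PM n) :
    rho n g (eps a b) = eps ((proj n g).1 a) ((proj n g).1 b) := by
  refine PB.eq_of_le_iff fun K => ?_
  rw [eps_le_iff]
  change (permPB (proj n g) (eps a b)).part ≤ K.part ↔ _
  rw [permPB_le_iff, eps_le_iff]
  change K.part ((proj n g).1⁻¹⁻¹ a) ((proj n g).1⁻¹⁻¹ b) ↔ _
  rw [inv_inv]

theorem tPerm_tPerm {n : ℕ} (i : Fin n) (x : PM n) : tPerm i (tPerm i x) = x := by
  apply PM.ext
  by_cases hi : i.1 = 0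
  · have h1 := tPerm_spec_zero i hi x
    have h2 := tPerm_spec_zero i hi (tPerm i x)
    omega
  · have h1 := tPerm_spec i hi x
    have h2 := tPerm_spec i hi (tPerm i x)
    omega

theorem rho_braidGen_eps {n : ℕ} (i : Fin n) (a b : PM n) :
    rho n (braidGen i) (eps a b) = eps (tPerm i a) (tPerm i b) := by
  rw [rho_eps, proj_braidGen]
  rfl

theorem proj_braidGen_inv {n : ℕ} (i : Fin n) : proj n (braidGen i)⁻¹ = t i := by
  rw [map_inv, proj_braidGen, inv_eq_iff_mul_eq_one]
  exact Subtype.ext (Equiv.ext (tPerm_tPerm i))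

/-- The generators act on partitions as involutions, so `tb9` asks for the same identity as `tb4`.
-/
theorem rho_braidGen_inv {n : ℕ} (i : Fin n) : rho n (braidGen i)⁻¹ = rho n (braidGen i) := by
  change permAction n (proj n _) = permAction n (proj n _)
  rw [proj_braidGen_inv, proj_braidGen]

theorem rho_rho_braidGen {n : ℕ} (i : Fin n) (I : PB n) :
    rho n (braidGen i) (rho n (braidGen i) I) = I := by
  nth_rewrite 1 [← rho_braidGen_inv]
  change (rho n (braidGen i)⁻¹ * rho n (braidGen i)) I = I
  rw [← map_mul, inv_mul_cancel, map_one]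
  rfl

theorem thetaPB_zero {n : ℕ} {i : Fin n} (hi : i.1 = 0) : thetaPB i = eps (-pos i) (pos i) :=
  dif_pos hi

theorem thetaPB_of_ne {n : ℕ} {i : Fin n} (hi : i.1 ≠ 0) :
    thetaPB i = eps (posPred i hi) (pos i) := dif_neg hi

theorem rho_thetaPB_self {n : ℕ} (i : Fin n) : rho n (braidGen i) (thetaPB i) = thetaPB i := by
  by_cases hi : i.1 = 0
  · rw [thetaPB_zero hi, rho_braidGen_eps]
    have h1 := tPerm_spec_zero i hi (pos i)
    have h2 := tPerm_spec_zero i hi (-pos i)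
    simp only [PM.val_neg, pos_val] at h1 h2
    refine eps_eq_eps ?_
    simp only [PM.val_neg, pos_val]
    omega
  · rw [thetaPB_of_ne hi, rho_braidGen_eps]
    have h1 := tPerm_spec i hi (pos i)
    have h2 := tPerm_spec i hi (posPred i hi)
    simp only [posPred_val, pos_val] at h1 h2
    refine eps_eq_eps ?_
    simp only [posPred_val, pos_val]
    omega

theorem rho_thetaPB_of_ne_one {n : ℕ} (i j : Fin n) (hij : |(i : ℤ) - j| ≠ 1) :
    rho n (braidGen i) (thetaPB j) = thetaPB j := by
  rw [Ne, abs_eq (by norm_num)] at hij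
  by_cases he : i = j
  · rw [he, rho_thetaPB_self]
  have he' : i.1 ≠ j.1 := fun h => he (Fin.ext h)
  by_cases hj : j.1 = 0
  · have hi : i.1 ≠ 0 := by omega
    rw [thetaPB_zero hj, rho_braidGen_eps]
    have h1 := tPerm_spec i hi (pos j)
    have h2 := tPerm_spec i hi (-pos j)
    simp only [PM.val_neg, pos_val] at h1 h2
    refine eps_eq_eps (Or.inl ?_)
    simp only [PM.val_neg, pos_val]
    omega
  · rw [thetaPB_of_ne hj, rho_braidGen_eps]
    have h3 : ∀ x : PM n, (x.1 = j ∨ x.1 = (j : ℤ) + 1) → (tPerm i x).1 = x.1 := by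
      intro x hx
      by_cases hi : i.1 = 0
      · have h1 := tPerm_spec_zero i hi x
        omega
      · have h1 := tPerm_spec i hi x
        omega
    exact eps_eq_eps (Or.inl ⟨h3 _ (Or.inl rfl), h3 _ (Or.inr rfl)⟩)

theorem rho_rho_thetaPB {n : ℕ} (i j : Fin n) (hi : 1 ≤ i.1) (hj : 1 ≤ j.1)
    (hij : |(i : ℤ) - j| = 1) :
    rho n (braidGen i) (rho n (braidGen j) (thetaPB i)) = thetaPB j := by
  have hi' : i.1 ≠ 0 := by omega
  have hj' : j.1 ≠ 0 := by omega
  rw [abs_eq (by norm_num)] at hij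
  rw [thetaPB_of_ne hi', thetaPB_of_ne hj', rho_braidGen_eps, rho_braidGen_eps]
  have h1 := tPerm_spec j hj' (posPred i hi')
  have h2 := tPerm_spec j hj' (pos i)
  have h3 := tPerm_spec i hi' (tPerm j (posPred i hi'))
  have h4 := tPerm_spec i hi' (tPerm j (pos i))
  simp only [posPred_val, pos_val] at h1 h2
  refine eps_eq_eps ?_
  simp only [posPred_val, pos_val]
  rcases hij with hij | hij
  · have h5 : (tPerm j (posPred i hi')).1 = (i : ℤ) - 1 := by omega
    have h6 : (tPerm j (pos i)).1 = (i : ℤ) + 1 := by omega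
    clear h1 h2
    omega
  · have h5 : (tPerm j (posPred i hi')).1 = (i : ℤ) := by omega
    have h6 : (tPerm j (pos i)).1 = (i : ℤ) + 2 := by omega
    clear h1 h2
    omega

section IndexZeroOne

variable {n : ℕ} {z o : Fin n}

theorem tPerm_pos_zero_one (hz : z.1 = 0) (ho : o.1 = 1) :
    tPerm z (pos z) = -pos z ∧ tPerm z (pos o) = pos o ∧ tPerm o (pos z) = pos o ∧
      tPerm o (pos o) = pos z := by
  have ho' : o.1 ≠ 0 := by omega
  have h1 := tPerm_spec_zero z hz (pos z)
  have h2 := tPerm_spec_zero z hz (pos o)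
  have h3 := tPerm_spec o ho' (pos z)
  have h4 := tPerm_spec o ho' (pos o)
  refine ⟨PM.ext ?_, PM.ext ?_, PM.ext ?_, PM.ext ?_⟩ <;>
    simp only [PM.val_neg, pos_val] at * <;> omega

theorem tPerm_neg {n : ℕ} (i : Fin n) (x : PM n) : tPerm i (-x) = -tPerm i x := tPerm_mem i x

theorem thetaPB_one (hz : z.1 = 0) (ho : o.1 = 1) : thetaPB o = eps (pos z) (pos o) := by
  rw [thetaPB_of_ne (by omega)]
  refine eps_eq_eps (Or.inl ⟨?_, rfl⟩)
  rw [posPred_val, pos_val]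
  omega

theorem rho_thetaPB_one (hz : z.1 = 0) (ho : o.1 = 1) :
    rho n (braidGen z) (thetaPB o) = eps (-pos z) (pos o) := by
  obtain ⟨h1, h2, -, -⟩ := tPerm_pos_zero_one hz ho
  rw [thetaPB_one hz ho, rho_braidGen_eps, h1, h2]

theorem rho_thetaPB_zero (hz : z.1 = 0) (ho : o.1 = 1) :
    rho n (braidGen o) (thetaPB z) = eps (-pos o) (pos o) := by
  obtain ⟨-, -, h3, -⟩ := tPerm_pos_zero_one hz ho
  rw [thetaPB_zero hz, rho_braidGen_eps, tPerm_neg, h3]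

theorem rho_fix_zero (hz : z.1 = 0) (ho : o.1 = 1) :
    rho n (braidGen o) (rho n (braidGen z) (rho n (braidGen o) (thetaPB z))) = thetaPB z := by
  obtain ⟨h1, h2, h3, h4⟩ := tPerm_pos_zero_one hz ho
  rw [rho_thetaPB_zero hz ho, rho_braidGen_eps, rho_braidGen_eps, thetaPB_zero hz]
  simp only [tPerm_neg, h2, h4]

theorem rho_fix_one (hz : z.1 = 0) (ho : o.1 = 1) :
    rho n (braidGen z) (rho n (braidGen o) (rho n (braidGen z) (thetaPB o))) = thetaPB o := by
  obtain ⟨h1, h2, h3, h4⟩ := tPerm_pos_zero_one hz ho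
  rw [rho_thetaPB_one hz ho, rho_braidGen_eps, rho_braidGen_eps, thetaPB_one hz ho]
  simp only [tPerm_neg, h1, h2, h3, h4]
  rw [eps_comm, eps_neg_neg]

end IndexZeroOne

/-- This is the partition content of `tb6_left`. For `j ≥ 1` both sides join the same three points
in two ways; for `j = 0` two zero blocks get merged. -/
theorem thetaPB_mul_rho {n : ℕ} (i j : Fin n) (hij : |(i : ℤ) - j| = 1) :
    thetaPB j * rho n (braidGen i) (thetaPB j) = thetaPB i * thetaPB j := by
  rw [abs_eq (by norm_num)] at hij
  by_cases hi : i.1 = 0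
  · have hj : j.1 = 1 := by omega
    rw [rho_thetaPB_one hi hj, thetaPB_one hi hj, thetaPB_zero hi, eps_comm (pos i),
      eps_comm (-pos i), ← eps_mul_eps, mul_comm, eps_comm (pos i)]
  by_cases hj : j.1 = 0
  · have hi : i.1 = 1 := by omega
    rw [rho_thetaPB_zero hj hi, thetaPB_one hj hi, thetaPB_zero hj, eps_neg_mul_eps_neg, mul_comm]
  rw [thetaPB_of_ne hi, thetaPB_of_ne hj, rho_braidGen_eps]
  have h1 := tPerm_spec i hi (posPred j hj)
  have h2 := tPerm_spec i hi (pos j)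
  simp only [posPred_val, pos_val] at h1 h2
  rcases hij with hij | hij
  · have h3 : pos j = posPred i hi := PM.ext (by rw [pos_val, posPred_val]; omega)
    have h4 : tPerm i (posPred j hj) = posPred j hj := PM.ext (by rw [posPred_val]; omega)
    have h5 : tPerm i (pos j) = pos i := PM.ext (by rw [pos_val]; omega)
    rw [h4, h5, ← eps_mul_eps, mul_comm, h3]
  · have h3 : posPred j hj = pos i := PM.ext (by rw [pos_val, posPred_val]; omega)
    have h4 : tPerm i (posPred j hj) = posPred i hi := PM.ext (by rw [posPred_val]; omega)
    have h5 : tPerm i (pos j) = pos j := PM.ext (by rw [pos_val]; omega)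
    rw [h4, h5, eps_comm, eps_comm (posPred i hi), ← eps_mul_eps, mul_comm,
      eps_comm (pos j), h3, eps_comm (posPred i hi)]

/-! ### The homomorphism to the tied monoid -/

/-- The images of the generators in the tied monoid. -/
def genImage {n : ℕ} : Gen n → TiedMonoid n
  | .sigma i => ⟨1, braidGen i⟩
  | .sigmaInv i => ⟨1, (braidGen i)⁻¹⟩
  | .theta i => ⟨thetaPB i, 1⟩

theorem genImage_sigma {n : ℕ} (i : Fin n) :
    FreeMonoid.lift genImage (s i) = (⟨1, braidGen i⟩ : TiedMonoid n) := rfl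

theorem genImage_sigmaInv {n : ℕ} (i : Fin n) :
    FreeMonoid.lift genImage (s' i) = (⟨1, (braidGen i)⁻¹⟩ : TiedMonoid n) := rfl

theorem genImage_theta {n : ℕ} (i : Fin n) :
    FreeMonoid.lift genImage (θ i) = (⟨thetaPB i, 1⟩ : TiedMonoid n) := rfl

theorem braidGen_rel {n : ℕ} {x y : FreeGroup (Fin n)} (h : BraidRel n (x * y⁻¹)) :
    (PresentedGroup.mk {r | BraidRel n r} x) = PresentedGroup.mk {r | BraidRel n r} y := by
  rw [← mul_inv_eq_one, ← map_inv, ← map_mul]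
  exact PresentedGroup.one_of_mem h

/-- In the semidirect product each relation splits into an identity of braids and an identity of
partitions. Simplification leaves at most one of the two to prove. -/
theorem genImage_rel {n : ℕ} (x y : FreeMonoid (Gen n)) (h : TiedRel n x y) :
    FreeMonoid.lift genImage x = FreeMonoid.lift genImage y := by
  cases h <;>
    simp only [map_mul, genImage_sigma, genImage_sigmaInv, genImage_theta, map_one,
      MonoidSemidirect.mul_def, MonoidSemidirect.one_def, mul_one, one_mul, Monoid.End.coe_one,
      id_eq, Monoid.End.coe_mul, Function.comp_apply, MonoidSemidirect.mk.injEq, mul_inv_cancel, inv_mul_cancel,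
      and_true, true_and, rho_braidGen_inv, rho_rho_braidGen]
  case bb1 z o hz ho => exact braidGen_rel (.bb1 z o hz ho)
  case bb2 i j hi hj hij => exact braidGen_rel (.bb2 i j hi hj hij)
  case bb3 i j hij => exact braidGen_rel (.bb3 i j hij)
  case tb1 i => exact PB.mul_self _
  case tb2 i j => exact mul_comm _ _
  case tb3_zero z o hz ho => exact (rho_fix_zero hz ho).symm
  case tb3_one z o hz ho => exact (rho_fix_one hz ho).symm
  case tb4 i j hi hj hij => exact rho_rho_thetaPB i j hi hj hij
  case tb5 i j hij => exact rho_thetaPB_of_ne_one i j hij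
  case tb6_left i j hij => exact (thetaPB_mul_rho i j hij).symm
  case tb6_right i j hij =>
    -- The involution `rho n (braidGen i)` exchanges the two factors of the product in
    -- `thetaPB_mul_rho`.
    rw [← map_mul, ← thetaPB_mul_rho i j hij, map_mul, rho_rho_braidGen, mul_comm]
  case tb7_zero z o hz ho => exact mul_comm _ _
  case tb7_one z o hz ho => exact mul_comm _ _
  case tb9 i j hi hj hij => exact rho_rho_thetaPB i j hi hj hij

/-- The homomorphism from the presented monoid to the tied monoid. -/
noncomputable def toTied (n : ℕ) : Presented n →* TiedMonoid n := PresentedMonoid.lift genImage genImage_rel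

theorem toTied_braidUnit {n : ℕ} (g : BraidB n) :
    toTied n (braidUnit n g) = (⟨1, g⟩ : TiedMonoid n) := by
  induction g using braidGen_induction with
  | one => rw [map_one, Units.val_one, map_one, MonoidSemidirect.one_def]
  | gen i =>
    rw [braidUnit_braidGen]
    rfl
  | mul x y hx hy =>
    rw [map_mul, Units.val_mul, map_mul, hx, hy, MonoidSemidirect.mul_def, map_one, mul_one]
  | inv x hx =>
    have h1 : (⟨1, x⟩ : TiedMonoid n) * ⟨1, x⁻¹⟩ = 1 := by
      rw [MonoidSemidirect.mul_def, map_one, mul_one, mul_inv_cancel, MonoidSemidirect.one_def]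
    rw [map_inv, ← mul_one (toTied n _), ← h1, ← mul_assoc, ← hx, ← map_mul, Units.inv_mul,
      map_one, one_mul]

theorem toTied_smul {n : ℕ} (g : BraidB n) {x : Presented n} {I : PB n}
    (h : toTied n x = ⟨I, 1⟩) : toTied n (braidConj n g • x) = ⟨rho n g I, 1⟩ := by
  rw [braidConj_smul, map_mul, map_mul, ← map_inv, toTied_braidUnit, toTied_braidUnit, h]
  simp [MonoidSemidirect.mul_def]

theorem toTied_thetaNat {n i : ℕ} (hi : i < n) :
    toTied n (thetaNat n i) = ⟨thetaPB ⟨i, hi⟩, 1⟩ := by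
  rw [thetaNat_of_lt hi]
  rfl

/-- Ties and the partitions `eps a b` transform alike under braids, so it suffices to compare them
at `{-1, 1}` and `{1, 2}`. -/
theorem toTied_tie {n : ℕ} (hn : 2 ≤ n) {a b : PM n} (hab : a ≠ b) :
    toTied n (tie a b) = ⟨eps a b, 1⟩ := by
  by_cases h : a.1.natAbs = b.1.natAbs
  · obtain rfl := (PM.natAbs_eq_natAbs_iff.1 h).resolve_left hab
    obtain ⟨g, hg⟩ := exists_braid_tuple 1 (by omega) ![b] (by
      intro i j _
      exact Subsingleton.elim i j)
    have hn0 : 0 < n := by omega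
    obtain rfl : (proj n g).1 (pos ⟨0, hn0⟩) = b := hg 0 _ rfl
    rw [← SignedPerm.map_neg, ← smul_tie hn, ← rho_eps, tie_neg_pos_zero]
    refine toTied_smul g ?_
    rw [toTied_thetaNat (by omega), thetaPB_zero rfl]
  · obtain ⟨g, rfl, rfl⟩ := exists_braid_two hn h
    rw [← smul_tie hn, ← rho_eps, tie_pos_pos hn hn]
    refine toTied_smul g ?_
    rw [toTied_thetaNat hn, thetaPB_one (z := ⟨0, by omega⟩) rfl rfl]

/-- The inclusion of the monoid of partitions in the tied monoid. -/
def tiedInl (n : ℕ) : PB n →* TiedMonoid n where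
  toFun I := ⟨I, 1⟩
  map_one' := rfl
  map_mul' I J := by simp [MonoidSemidirect.mul_def]

theorem toTied_tieProd {n : ℕ} (hn : 2 ≤ n) (I : PB n) :
    toTied n (tieProd I) = ⟨I, 1⟩ := by
  change _ = tiedInl n I
  conv_rhs => rw [← prod_eps I]
  rw [tieProd, map_list_prod, map_list_prod, List.map_map, List.map_map]
  exact congrArg _ (List.map_congr_left fun p hp => toTied_tie hn (mem_relatedPairs.1 hp).1)

/-- The homomorphism from the tied monoid to the presented monoid. -/
noncomputable def ofTied {n : ℕ} (hn : 2 ≤ n) : TiedMonoid n →* Presented n where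
  toFun x := tieProd x.left * braidUnit n x.right
  map_one' := by
    rw [MonoidSemidirect.one_def, tieProd_one, map_one, Units.val_one, mul_one]
  map_mul' x y := by
    -- Equivariance of `tieProd` makes the twist by `rho` in the semidirect product into conjugation
    -- by the braid, and the adjacent inverse braids then cancel.
    rw [MonoidSemidirect.mul_def, tieProd_mul hn, ← smul_tieProd hn, map_mul, Units.val_mul,
      braidConj_smul]
    simp [mul_assoc]

theorem ofTied_apply {n : ℕ} (hn : 2 ≤ n) (I : PB n) (g : BraidB n) :
    ofTied hn ⟨I, g⟩ = tieProd I * braidUnit n g := rfl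

theorem toTied_ofTied {n : ℕ} (hn : 2 ≤ n) (x : TiedMonoid n) :
    toTied n (ofTied hn x) = x := by
  obtain ⟨I, g⟩ := x
  rw [ofTied_apply, map_mul, toTied_tieProd hn, toTied_braidUnit]
  simp [MonoidSemidirect.mul_def]

theorem tieProd_thetaPB {n : ℕ} (hn : 2 ≤ n) (i : Fin n) : tieProd (thetaPB i) = thetaGen i := by
  by_cases hi : i.1 = 0
  · have hne : -pos i ≠ pos i := fun h => by
      have := congrArg Subtype.val h
      rw [PM.val_neg, pos_val] at this
      omega
    have hn0 : 0 < n := by omega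
    obtain rfl : i = ⟨0, hn0⟩ := Fin.ext hi
    rw [thetaPB_zero hi, tieProd_eps hn hne, tie_neg_pos_zero, thetaNat_of_lt]
  · obtain ⟨i, hin⟩ := i
    obtain ⟨k, rfl⟩ : ∃ k, i = k + 1 := Nat.exists_eq_succ_of_ne_zero hi
    have hp : posPred (⟨k + 1, hin⟩ : Fin n) hi = pos ⟨k, by omega⟩ :=
      PM.ext (by rw [pos_val, posPred_val]; simp)
    have hne : pos (⟨k, by omega⟩ : Fin n) ≠ pos ⟨k + 1, hin⟩ := fun h => by
      have := congrArg Subtype.val h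
      rw [pos_val, pos_val] at this
      simp at this
    rw [thetaPB_of_ne hi, hp, tieProd_eps hn hne, tie_pos_pos hn hin, thetaNat_of_lt hin]

theorem ofTied_toTied {n : ℕ} (hn : 2 ≤ n) (x : Presented n) :
    ofTied hn (toTied n x) = x := by
  have h : (ofTied hn).comp (toTied n) = MonoidHom.id _ := by
    refine PresentedMonoid.ext _ fun x => ?_
    cases x with
    | sigma i =>
      change tieProd (1 : PB n) * ((braidUnit n (braidGen i) : (Presented n)ˣ) : Presented n) = sigmaUnit i
      rw [tieProd_one, one_mul, braidUnit_braidGen]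
    | sigmaInv i =>
      change tieProd (1 : PB n) * ((braidUnit n (braidGen i)⁻¹ : (Presented n)ˣ) : Presented n) =
        ((sigmaUnit i)⁻¹ : (Presented n)ˣ)
      rw [tieProd_one, one_mul, map_inv, braidUnit_braidGen]
    | theta i =>
      change tieProd (thetaPB i) * ((braidUnit n 1 : (Presented n)ˣ) : Presented n) = thetaGen i
      rw [map_one, Units.val_one, mul_one, tieProd_thetaPB hn]
  exact DFunLike.congr_fun h x

end TiedB

theorem theorem5p1 (n : ℕ) (hn : 2 ≤ n) :
    ∃ e : TiedB.Presented n ≃* TiedB.TiedMonoid n,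
      (∀ i : Fin n, e (PresentedMonoid.of _ (.sigma i)) = ⟨1, TiedB.braidGen i⟩) ∧
      (∀ i : Fin n, e (PresentedMonoid.of _ (.sigmaInv i)) = ⟨1, (TiedB.braidGen i)⁻¹⟩) ∧
      (∀ i : Fin n, e (PresentedMonoid.of _ (.theta i)) = ⟨TiedB.thetaPB i, 1⟩) :=
  ⟨{ TiedB.toTied n with
      invFun := TiedB.ofTied hn
      left_inv := TiedB.ofTied_toTied hn
      right_inv := TiedB.toTied_ofTied hn }, fun _ => rfl, fun _ => rfl, fun _ => rfl⟩
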